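/- **Setting.** Let $K\ge 2$ and $n$ be integers. A clustering of $n$ nodes into $K$ communities is a matrix $Z\in\{0,1\}^{n\times K}$ with exactly one $1$ in each row; $\mathcal M_{n,K}$ is the set of all of them, $\mathcal N_k$ is the set of nodes $i$ with $Z_{i,k}=1$, and $n_k=|\mathcal N_k|$. For $B\in\mathbb R^{n\times n}$, $B^{(k,l)}(Z)$ denotes the submatrix of $B$ with rows in $\mathcal N_k$ and columns in $\mathcal N_l$. A sparsity set is a set $J\subseteq\{1,\dots,n\}\times\{1,\dots,K\}$; given $Z$, put $J_{k,l}=\{i\in\mathcal N_k:(i,l)\in J\}$, so that $|J|=\sum_{k,l}|J_{k,l}|$, and $J^{(k,l)}=J_{k,l}\times J_{l,k}$. $\Pi_{J^{(k,l)}}$ sets to zero the entries outside $J^{(k,l)}$, and $\Pi_{(1)}(X)$ is a best approximation of $X$ in Frobenius norm by matrices of rank at most one. **Model.** Let $Z_*\in\mathcal M_{n,K}$ be the true clustering with assignment $c$ ($c(i)=k$ iff $(Z_*)_{i,k}=1$), let $\Lambda\in[0,1]^{n\times K}$ and $(P_*)_{i,j}=\Lambda_{i,c(j)}\Lambda_{j,c(i)}$;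 that is, $P_*^{(k,l)}(Z_*)=\Lambda^{(k,l)}[\Lambda^{(l,k)}]^T$, where $\Lambda^{(k,l)}\in[0,1]^{n_k}$ is the part of column $l$ of $\Lambda$ with rows in the $k$-th true community. Assume (A1): for each $k$ the vectors $\Lambda^{(k,1)},\dots,\Lambda^{(k,K)}$ are linearly independent. Let $J_*=\{(i,l):\Lambda_{i,l}\ne0\}$ and, for $Z\in\mathcal M_{n,K}$, let $\breve J_*(Z)$ be the sparsity set whose part $(\breve J_*)_{k,l}$ is the set of nonzero rows of $P_*^{(k,l)}(Z)$. The adjacency matrix $A\in\{0,1\}^{n\times n}$ is random and symmetric, its entries $A_{i,j}$, $i\le j$, are independent, and $A_{i,j}\sim\mathrm{Bernoulli}((P_*)_{i,j})$. (The result is claimed both if this holds for all $i\le j$, and if it holds for $i<j$ while $A_{i,i}=0$ for all $i$.) **Estimator.** Let $\beta_1,\beta_2>0$ be constants and let $\mathrm{Pen}$ be the separable penalty $$\beta_1\sum_{k,l=1}^K|J_{k,l}|\ln\frac{n_ke}{|J_{k,l}|}+\beta_2K\sum_{k=1}^K\ln n_k+\beta_2[n\ln K+\ln n]$$ or the non-separable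 penalty $$\beta_1|J|\ln\frac{nKe}{|J|}+2\beta_2\ln n+\beta_2[n\ln K+\ln n]$$ (with $0\ln(\cdot/0)=0$, and a community with $n_k=0$ contributing nothing to $\sum_k\ln n_k$). Let $(\hat Z,\hat J)$ minimize $$\sum_{k,l=1}^K\big\|A^{(k,l)}(Z)-\Pi_{(1)}\big(\Pi_{J^{(k,l)}}(A^{(k,l)}(Z))\big)\big\|_F^2+\mathrm{Pen}$$ over all $Z\in\mathcal M_{n,K}$ and all sparsity sets $J$. The proportion of nodes misclassified by $Z$ is $\mathrm{Err}(Z,Z_*)=(2n)^{-1}\min_{Q}\|ZQ-Z_*\|_1$, with $Q$ ranging over the $K\times K$ permutation matrices and $\|\cdot\|_1$ the sum of the absolute values of the entries, and $\Upsilon(Z_*,\delta)=\{Z\in\mathcal M_{n,K}:\mathrm{Err}(Z,Z_*)\ge\delta\}$. **Theorem 2.** For all $\beta_1,\beta_2>0$ there are constants $H_1,H_2>0$, depending only on $\beta_1,\beta_2$ (in particular not on $n$, $K$, $Z_*$, $\Lambda$, $J_*$, $\breve J_*(Z)$, $\alpha_n$, $\delta_n$, $t$), such that the following holds in the above setting.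 If for some $\alpha_n\in(0,1/2)$, $\delta_n\in(0,1)$ and $t>0$ $$\|P_*\|_F^2\ \ge\ \max_{Z\in\Upsilon(Z_*,\delta_n)}\Big[(1+\alpha_n)\sum_{k,l=1}^K\|P_*^{(k,l)}(Z)\|_{op}^2+\frac{H_1}{\alpha_n}|\breve J_*(Z)|\ln\frac{nKe}{|\breve J_*(Z)|}\Big]+\frac{H_1}{\alpha_n}\big(|J_*|+n\ln K+t\big)+H_2|J_*|\ln\frac{nKe}{|J_*|}$$ (a condition regarded as satisfied if $\Upsilon(Z_*,\delta_n)=\emptyset$), then with probability at least $1-2e^{-t}$ the proportion of nodes misclassified by $\hat Z$ is at most $\delta_n$, for every solution $(\hat Z,\hat J)$ of the minimization problem. -/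

import Mathlib

open MeasureTheory ProbabilityTheory

noncomputable section

namespace PABM

/-! ### Matrix norms, projections and rank one approximation -/

/-- The squared Frobenius norm of a real matrix. -/
def frobSq {m n : Type*} [Fintype m] [Fintype n] (X : Matrix m n ℝ) : ℝ :=
  ∑ i, ∑ j, X i j ^ 2

/-- The entrywise `ℓ₁` norm of a real matrix. -/
def l1Norm {m n : Type*} [Fintype m] [Fintype n] (X : Matrix m n ℝ) : ℝ :=
  ∑ i, ∑ j, |X i j|

/-- The spectral norm: the operator norm of `X` between Euclidean spaces. -/
def opNorm {m n : Type*} [Fintype m] [Fintype n] [DecidableEq n] (X : Matrix m n ℝ) : ℝ :=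
  ‖LinearMap.toContinuousLinearMap (Matrix.toEuclideanLin X)‖

/-- The projection of `X` onto the matrices supported on the rectangle `S × T`. -/
def rectProj {m n : Type*} [DecidableEq m] [DecidableEq n] (S : Finset m) (T : Finset n)
    (X : Matrix m n ℝ) : Matrix m n ℝ :=
  Matrix.of fun i j => if i ∈ S ∧ j ∈ T then X i j else 0

/-- `Y` is a best approximation of `X`, in Frobenius norm, by matrices of rank at most one. -/
def IsBestRankOne {m n : Type*} [Fintype m] [Fintype n] (X Y : Matrix m n ℝ) : Prop :=
  Y.rank ≤ 1 ∧ ∀ M : Matrix m n ℝ, M.rank ≤ 1 → frobSq (X - Y) ≤ frobSq (X - M)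

theorem rank_le_one_iff_minors {m n : Type*} [Fintype m] [Fintype n] (M : Matrix m n ℝ) :
    M.rank ≤ 1 ↔ ∀ i i' j j', M i j * M i' j' = M i j' * M i' j := by
  classical
  constructor
  · intro h i i' j j'
    obtain ⟨v, hv⟩ := finrank_le_one_iff.mp h
    have key : ∀ j, ∃ a : ℝ, ∀ i, M i j = a * v.1 i := by
      intro j
      obtain ⟨a, ha⟩ := hv ⟨M.mulVecLin (Pi.single j 1), ⟨_, rfl⟩⟩
      refine ⟨a, fun i => ?_⟩
      have := congrFun (congrArg Subtype.val ha) i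
      simp at this
      exact this.symm
    obtain ⟨a, ha⟩ := key j
    obtain ⟨b, hb⟩ := key j'
    rw [ha, hb, ha, hb]; ring
  · intro h
    by_cases h0 : M = 0
    · subst h0; simp
    · have : ∃ i j, M i j ≠ 0 := by
        by_contra! hc
        exact h0 (Matrix.ext hc)
      obtain ⟨i, j, hij⟩ := this
      have : M = Matrix.vecMulVec (fun i' => M i' j / M i j) (M i) := by
        ext i' j'
        rw [Matrix.vecMulVec_apply]
        field_simp
        rw [h i' i j' j]
      rw [this]
      exact Matrix.rank_vecMulVec_le _ _

theorem exists_isBestRankOne {m n : Type*} [Fintype m] [Fintype n] (X : Matrix m n ℝ) :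
    ∃ Y, IsBestRankOne X Y := by
  have hcont : Continuous fun M : Matrix m n ℝ => frobSq (X - M) := by
    unfold frobSq
    simp only [Matrix.sub_apply]
    fun_prop
  have hcl : IsClosed {M : Matrix m n ℝ | M.rank ≤ 1} := by
    simp only [rank_le_one_iff_minors, Set.ofPred_forall]
    refine isClosed_iInter fun i => isClosed_iInter fun i' => isClosed_iInter fun j =>
      isClosed_iInter fun j' => isClosed_eq ?_ ?_ <;> fun_prop
  have hbox : IsCompact {M : Matrix m n ℝ | ∀ i j,
      M i j ∈ Set.Icc (X i j - √(frobSq X)) (X i j + √(frobSq X))} := by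
    have := isCompact_univ_pi fun i : m => isCompact_univ_pi fun j : n =>
      (isCompact_Icc : IsCompact (Set.Icc (X i j - √(frobSq X)) (X i j + √(frobSq X))))
    have hEq : {M : Matrix m n ℝ | ∀ i j,
        M i j ∈ Set.Icc (X i j - √(frobSq X)) (X i j + √(frobSq X))} =
        Set.pi Set.univ fun i : m => Set.pi Set.univ fun j : n =>
          Set.Icc (X i j - √(frobSq X)) (X i j + √(frobSq X)) := by
      apply Set.ext
      intro M
      exact ⟨fun h i _ j _ => h i j, fun h i j => h i trivial j trivial⟩
    rw [hEq]
    exact this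
  have h0 : (0 : Matrix m n ℝ).rank ≤ 1 := by simp
  have hentry : ∀ (M : Matrix m n ℝ) i j, |M i j| ≤ √(frobSq M) := by
    intro M i j
    apply Real.abs_le_sqrt
    calc M i j ^ 2 ≤ ∑ j, M i j ^ 2 :=
          Finset.single_le_sum (f := fun j => M i j ^ 2) (fun _ _ => sq_nonneg _)
            (Finset.mem_univ j)
      _ ≤ frobSq M :=
          Finset.single_le_sum (f := fun i => ∑ j, M i j ^ 2)
            (fun _ _ => Finset.sum_nonneg fun _ _ => sq_nonneg _) (Finset.mem_univ i)
  have hmem : ∀ M : Matrix m n ℝ, frobSq (X - M) ≤ frobSq X →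
      M ∈ {M : Matrix m n ℝ | ∀ i j,
        M i j ∈ Set.Icc (X i j - √(frobSq X)) (X i j + √(frobSq X))} := by
    intro M hM i j
    have h1 := (hentry (X - M) i j).trans (Real.sqrt_le_sqrt hM)
    rw [Matrix.sub_apply, abs_le] at h1
    constructor <;> linarith [h1.1, h1.2]
  obtain ⟨Y, hY, hmin⟩ := (hbox.inter_right hcl).exists_isMinOn
    ⟨0, hmem 0 (by simp), h0⟩ hcont.continuousOn
  refine ⟨Y, hY.2, fun M hM => ?_⟩
  by_cases hle : frobSq (X - M) ≤ frobSq X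
  · exact hmin ⟨hmem M hle, hM⟩
  · have h2 : frobSq (X - Y) ≤ frobSq (X - 0) := hmin ⟨hmem 0 (by simp), h0⟩
    rw [sub_zero] at h2
    linarith

/-- The best rank one approximation of `X`. (If it is not unique, one is chosen; the residual
`frobSq (X - rankOneApprox X)` does not depend on the choice.) -/
def rankOneApprox {m n : Type*} [Fintype m] [Fintype n] (X : Matrix m n ℝ) : Matrix m n ℝ :=
  (exists_isBestRankOne X).choose

theorem rankOneApprox_spec {m n : Type*} [Fintype m] [Fintype n] (X : Matrix m n ℝ) :
    IsBestRankOne X (rankOneApprox X) :=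
  (exists_isBestRankOne X).choose_spec

/-! ### Clusterings, blocks and sparsity sets -/

/-- A clustering of `n` nodes into `K` communities: the vector of community assignments. -/
abbrev Clustering (n K : ℕ) : Type := Fin n → Fin K

/-- The clustering matrix in `{0,1}^{n × K}`: entry `(i, k)` is one iff node `i` is in
community `k`. -/
def clusteringMatrix {n K : ℕ} (Z : Clustering n K) : Matrix (Fin n) (Fin K) ℝ :=
  Matrix.of fun i k => if Z i = k then 1 else 0

/-- The set of nodes of community `k`. -/
abbrev Community {n K : ℕ} (Z : Clustering n K) (k : Fin K) : Type := {i : Fin n // Z i = k}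

/-- The size `n_k` of community `k`. -/
def commSize {n K : ℕ} (Z : Clustering n K) (k : Fin K) : ℕ := Fintype.card (Community Z k)

/-- The `(k, l)` block of `B` under the clustering `Z`: rows in community `k`, columns in
community `l`. -/
def block {n K : ℕ} (Z : Clustering n K) (B : Matrix (Fin n) (Fin n) ℝ) (k l : Fin K) :
    Matrix (Community Z k) (Community Z l) ℝ :=
  B.submatrix Subtype.val Subtype.val

/-- A sparsity set is a set `J` of positions of an `n × K` matrix. Its part `J_{k,l}` consists
of the nodes `i` of community `k` with `(i, l) ∈ J`; thus `J` is the disjoint union of the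
`J_{k,l}`. -/
def part {n K : ℕ} (Z : Clustering n K) (J : Finset (Fin n × Fin K)) (k l : Fin K) :
    Finset (Community Z k) :=
  Finset.univ.filter fun i => (i.1, l) ∈ J

/-- The proportion of nodes misclustered by `Z`, up to relabeling of the communities. -/
def misclustered {n K : ℕ} (Z Zstar : Clustering n K) : ℝ :=
  (2 * (n : ℝ))⁻¹ * ⨅ σ : Equiv.Perm (Fin K),
    l1Norm (clusteringMatrix Z * σ.permMatrix ℝ - clusteringMatrix Zstar)

/-- The clusterings whose proportion of misclustered nodes is at least `δ`. -/
def farClusterings {n K : ℕ} (Zstar : Clustering n K) (δ : ℝ) : Set (Clustering n K) :=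
  {Z | δ ≤ misclustered Z Zstar}

/-! ### The popularity adjusted block model -/

/-- The matrix of connection probabilities: the entry for `i` in community `k` and `j` in
community `l` is `Λ^{(k,l)}_i Λ^{(l,k)}_j`, where `Λ i l` is the popularity of node `i` with
respect to community `l`. -/
def probMatrix {n K : ℕ} (Z : Clustering n K) (L : Matrix (Fin n) (Fin K) ℝ) :
    Matrix (Fin n) (Fin n) ℝ :=
  Matrix.of fun i j => L i (Z j) * L j (Z i)

/-- For every community `k`, the vectors `Λ^{(k,1)}, …, Λ^{(k,K)}` are linearly independent. -/
def LinIndepPopularities {n K : ℕ} (Z : Clustering n K) (L : Matrix (Fin n) (Fin K) ℝ) : Prop :=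
  ∀ k : Fin K, LinearIndependent ℝ fun (l : Fin K) (i : Community Z k) => L i.1 l

open Classical in
/-- The set of positions of the nonzero elements of `Λ`. -/
def supportSet {n K : ℕ} (L : Matrix (Fin n) (Fin K) ℝ) : Finset (Fin n × Fin K) :=
  Finset.univ.filter fun p => L p.1 p.2 ≠ 0

open Classical in
/-- The sparsity set of `P` under an arbitrary clustering `Z`: its `(k, l)` part consists of the
nonzero rows of the block `P^{(k,l)}(Z)`. -/
def blockSupport {n K : ℕ} (Z : Clustering n K) (P : Matrix (Fin n) (Fin n) ℝ) :
    Finset (Fin n × Fin K) :=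
  Finset.univ.filter fun p => ∃ j, Z j = p.2 ∧ P p.1 j ≠ 0

/-- `A` is a random symmetric `{0,1}` matrix whose entries on and above the diagonal are
independent and Bernoulli with means given by `P`. For the diagonal there are two conventions:
its entries are Bernoulli with means given by `P` like all the others, or there are no
self-loops at all. -/
structure IsRandomAdjacency {n : ℕ} {Ω : Type*} [MeasurableSpace Ω] (μ : Measure Ω)
    (A : Ω → Matrix (Fin n) (Fin n) ℝ) (P : Matrix (Fin n) (Fin n) ℝ) : Prop where
  measurable : ∀ i j, Measurable fun ω => A ω i j
  zero_or_one : ∀ ω i j, A ω i j = 0 ∨ A ω i j = 1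
  symm : ∀ ω i j, A ω i j = A ω j i
  indep : iIndepFun (fun (p : {p : Fin n × Fin n // p.1 ≤ p.2}) ω => A ω p.1.1 p.1.2) μ
  prob : ∀ i j, i < j → μ.real {ω | A ω i j = 1} = P i j
  diag : (∀ i, μ.real {ω | A ω i i = 1} = P i i) ∨ (∀ ω i, A ω i i = 0)

/-! ### The penalized estimator -/

/-- `x ln (N e / x)`, with value `0` at `x = 0`. -/
def entropyTerm (N x : ℕ) : ℝ := (x : ℝ) * Real.log (N * Real.exp 1 / x)

/-- The part of the penalties that does not depend on the sparsity set. -/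
def penBase (β₂ : ℝ) (n K : ℕ) : ℝ := β₂ * (n * Real.log K + Real.log n)

/-- The separable penalty; an empty community contributes `0` to the sum of the `ln n_k`. -/
def sepPenalty (β₁ β₂ : ℝ) {n K : ℕ} (Z : Clustering n K) (J : Finset (Fin n × Fin K)) : ℝ :=
  β₁ * ∑ k, ∑ l, entropyTerm (commSize Z k) (part Z J k l).card
    + β₂ * K * ∑ k, Real.log (commSize Z k) + penBase β₂ n K

/-- The non-separable penalty. -/
def nonsepPenalty (β₁ β₂ : ℝ) {n K : ℕ} (_Z : Clustering n K) (J : Finset (Fin n × Fin K)) : ℝ :=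
  β₁ * entropyTerm (n * K) J.card + 2 * β₂ * Real.log n + penBase β₂ n K

/-- The penalized criterion: the squared distance of every block of `A` to the best rank one
approximation of its restriction to `J_{k,l} × J_{l,k}`, plus the penalty. -/
def criterion {n K : ℕ} (pen : Clustering n K → Finset (Fin n × Fin K) → ℝ)
    (A : Matrix (Fin n) (Fin n) ℝ) (Z : Clustering n K) (J : Finset (Fin n × Fin K)) : ℝ :=
  ∑ k, ∑ l, frobSq (block Z A k l -
      rankOneApprox (rectProj (part Z J k l) (part Z J l k) (block Z A k l)))
    + pen Z J

/-- `(Z, J)` minimizes the penalized criterion over all clusterings and sparsity sets. -/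
def IsSolution {n K : ℕ} (pen : Clustering n K → Finset (Fin n × Fin K) → ℝ)
    (A : Matrix (Fin n) (Fin n) ℝ) (Z : Clustering n K) (J : Finset (Fin n × Fin K)) : Prop :=
  ∀ Z' J', criterion pen A Z J ≤ criterion pen A Z' J'

/-- The lower bound required of the squared Frobenius norm of the probability matrix, uniformly
over all clusterings with a proportion of misclustered nodes of at least `δ`. -/
def SeparationCondition (H₁ H₂ α δ t : ℝ) {n K : ℕ} (Zstar : Clustering n K)
    (L : Matrix (Fin n) (Fin K) ℝ) : Prop :=
  ∀ Z ∈ farClusterings Zstar δ,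
    ((1 + α) * ∑ k, ∑ l, opNorm (block Z (probMatrix Zstar L) k l) ^ 2
        + H₁ / α * entropyTerm (n * K) (blockSupport Z (probMatrix Zstar L)).card)
      + H₁ / α * ((supportSet L).card + n * Real.log K + t)
      + H₂ * entropyTerm (n * K) (supportSet L).card
    ≤ frobSq (probMatrix Zstar L)

end PABM

end

/-!
Write `P = P_*` and let `M` be the mean of `A`, which equals `P` except perhaps on the diagonal.
Since a matrix of rank at most one satisfies `‖X‖_F² - ‖X‖_op² ≤ ‖X - Y‖_F²`, comparing the
criterion at a solution `(Ẑ, Ĵ)` with its value at `(Z_*, J_*)`, where the blocks of `P` compete as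
approximations of rank one, bounds `‖P‖_F²` by `∑ ‖A^{(k,l)}(Ẑ)‖_op² - 2⟨A - M, P⟩` plus the
penalty of `(Z_*, J_*)` and the contribution of the diagonal. The penalty costs at most a multiple
of `|J_*| ln (nKe / |J_*|)`: by concavity of the entropy the separable penalty is dominated by the
non-separable one, and no part of `J_*` is empty.

Splitting `A = P + (A - P)` in each block replaces `∑ ‖A^{(k,l)}(Ẑ)‖_op²` by
`(1 + α/4) ∑ ‖P^{(k,l)}(Ẑ)‖_op²` plus `O(1/α)` times the noise `∑ ‖(A - M)^{(k,l)}(Ẑ)‖_op²`. The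
square root of this noise is the supremum of `⟨A - M, W⟩` over matrices `W` of unit Frobenius norm
whose blocks have rank one; since `A - M` almost surely vanishes where `P` does, the factors of the
blocks may be taken supported on `J = blockSupport Ẑ P`. Up to a factor 4 the supremum is attained
on a net with `25 ^ |J|` elements, so the sub-Gaussian tails of the linear forms `⟨A - M, W⟩` and a
union bound over the net and over the `K ^ n` clusterings control the noise at the level
`|J| + n ln K + t`. If `Ẑ` were far from `Z_*`, these bounds would contradict the separation
condition.
-/

noncomputable section

namespace PABM

section Nets

open Metric Module

variable {E : Type*} [NormedAddCommGroup E] [NormedSpace ℝ E]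

theorem packingNumber_closedBall_le [FiniteDimensional ℝ E] :
    packingNumber (1 / 2) (closedBall (0 : E) 1) ≤ (5 ^ finrank ℝ E : ℕ) := by
  classical
  refine iSup₂_le fun C hC => iSup_le fun hsep => le_of_not_gt fun hlt => ?_
  obtain ⟨C', hC', hcard⟩ := Set.exists_subset_encard_eq (Order.add_one_le_of_lt hlt)
  lift C' to Finset E using Set.finite_of_encard_eq_coe (by exact_mod_cast hcard)
  have hdist : ∀ x ∈ C', ∀ y ∈ C', x ≠ y → 1 / 2 < ‖x - y‖ := fun x hx y hy hxy => by
    have h : ((1 / 2 : NNReal) : ENNReal) < edist x y := hsep (hC' hx) (hC' hy) hxy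
    rw [edist_nndist, ENNReal.coe_lt_coe, ← NNReal.coe_lt_coe, coe_nndist, dist_eq_norm] at h
    simpa using h
  have hle : (C'.image fun x => (2 : ℝ) • x).card ≤ 5 ^ finrank ℝ E := by
    refine Besicovitch.card_le_of_separated _ ?_ ?_
    · simp only [Finset.forall_mem_image, norm_smul, Real.norm_ofNat]
      intro x hx
      linarith [mem_closedBall_zero_iff.mp (hC (hC' hx))]
    · simp only [Finset.forall_mem_image, ← smul_sub, norm_smul, Real.norm_ofNat]
      intro x hx y hy hxy
      linarith [hdist x hx y hy fun h => hxy (by rw [h])]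
  rw [Finset.card_image_of_injective _ (smul_right_injective E two_ne_zero)] at hle
  rw [Set.encard_coe_eq_coe_finsetCard] at hcard
  have : C'.card = 5 ^ finrank ℝ E + 1 := by exact_mod_cast hcard
  omega

theorem exists_isCover_closedBall_card_le [FiniteDimensional ℝ E] :
    ∃ N : Finset E, N.card ≤ 5 ^ finrank ℝ E ∧ ↑N ⊆ closedBall (0 : E) 1 ∧
      IsCover (1 / 2) (closedBall (0 : E) 1) (N : Set E) := by
  have hle := packingNumber_closedBall_le (E := E)
  have htop := ne_top_of_le_ne_top (ENat.natCast_ne_top _) hle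
  have hcard := (encard_maximalSeparatedSet htop).trans_le hle
  lift maximalSeparatedSet (1 / 2) (closedBall (0 : E) 1) to Finset E using
    Set.finite_of_encard_le_coe hcard with N hN
  rw [Set.encard_coe_eq_coe_finsetCard] at hcard
  exact ⟨N, by exact_mod_cast hcard, hN ▸ maximalSeparatedSet_subset,
    hN ▸ isCover_maximalSeparatedSet htop⟩

theorem opNorm_le_two_mul_of_isCover {N : Set E} (hN : IsCover (1 / 2) (closedBall (0 : E) 1) N)
    (f : E →L[ℝ] ℝ) {c : ℝ} (hf : ∀ y ∈ N, f y ≤ c) : ‖f‖ ≤ 2 * c := by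
  have hle : ∀ x : E, ‖x‖ ≤ 1 → f x ≤ c + ‖f‖ / 2 := fun x hx => by
    obtain ⟨y, hy, hxy⟩ := Set.mem_iUnion₂.mp
      (isCover_iff_subset_iUnion_closedBall.mp hN (mem_closedBall_zero_iff.mpr hx))
    rw [mem_closedBall, dist_eq_norm] at hxy
    calc f x = f y + f (x - y) := by rw [map_sub]; ring
      _ ≤ c + ‖f‖ * (1 / 2) :=
        add_le_add (hf y hy) ((le_abs_self _).trans (f.le_opNorm_of_le (by simpa using hxy)))
      _ = c + ‖f‖ / 2 := by ring
  have hnorm : ‖f‖ ≤ c + ‖f‖ / 2 := by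
    refine f.opNorm_le_of_unit_norm (by simpa using hle 0 (by simp)) fun x hx => abs_le.mpr ⟨?_, ?_⟩
    · linarith [hle (-x) (by rw [norm_neg, hx]), map_neg f x]
    · exact hle x hx.le
  linarith

variable {W : Type*} [AddCommGroup W] [Module ℝ W] [FiniteDimensional ℝ W]

theorem exists_finset_forall_le_two_mul_norm (φ : W →ₗ[ℝ] E) (hφ : Function.Injective φ) :
    ∃ N : Finset W, N.card ≤ 5 ^ finrank ℝ W ∧ (∀ w ∈ N, ‖φ w‖ ≤ 1) ∧
      ∀ (f : W →ₗ[ℝ] ℝ) (c : ℝ), (∀ w ∈ N, f w ≤ c) → ∀ w, f w ≤ 2 * c * ‖φ w‖ := by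
  classical
  let e : W ≃ₗ[ℝ] LinearMap.range φ := LinearEquiv.ofInjective φ hφ
  obtain ⟨N, hcard, hball, hcover⟩ := exists_isCover_closedBall_card_le (E := LinearMap.range φ)
  have hnorm : ∀ x, ‖φ (e.symm x)‖ = ‖x‖ := fun x =>
    congrArg norm (congrArg Subtype.val (e.apply_symm_apply x))
  refine ⟨N.image e.symm, ?_, ?_, fun f c hf w => ?_⟩
  · rw [e.finrank_eq]
    exact Finset.card_image_le.trans hcard
  · simp only [Finset.forall_mem_image, hnorm]
    exact fun x hx => mem_closedBall_zero_iff.mp (hball hx)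
  · let g : LinearMap.range φ →L[ℝ] ℝ := LinearMap.toContinuousLinearMap (f ∘ₗ e.symm)
    have hg : ‖g‖ ≤ 2 * c :=
      opNorm_le_two_mul_of_isCover hcover g fun x hx => hf _ (Finset.mem_image_of_mem _ hx)
    calc f w = g (e w) := (congrArg f (e.symm_apply_apply w)).symm
      _ ≤ ‖g‖ * ‖e w‖ := (le_abs_self _).trans (g.le_opNorm _)
      _ ≤ 2 * c * ‖φ w‖ := mul_le_mul_of_nonneg_right hg (norm_nonneg _)

theorem exists_finset_forall_bilin_le_four_mul_norm {E' W' : Type*} [NormedAddCommGroup E']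
    [NormedSpace ℝ E'] [AddCommGroup W'] [Module ℝ W'] [FiniteDimensional ℝ W']
    (φ : W →ₗ[ℝ] E) (hφ : Function.Injective φ) (ψ : W' →ₗ[ℝ] E') (hψ : Function.Injective ψ) :
    ∃ N : Finset (W × W'), N.card ≤ 5 ^ (finrank ℝ W + finrank ℝ W') ∧
      (∀ p ∈ N, ‖φ p.1‖ ≤ 1 ∧ ‖ψ p.2‖ ≤ 1) ∧
      ∀ (B : W →ₗ[ℝ] W' →ₗ[ℝ] ℝ) (c : ℝ), (∀ p ∈ N, B p.1 p.2 ≤ c) →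
        ∀ u v, B u v ≤ 4 * c * (‖φ u‖ * ‖ψ v‖) := by
  obtain ⟨N₁, hcard₁, hball₁, hle₁⟩ := exists_finset_forall_le_two_mul_norm φ hφ
  obtain ⟨N₂, hcard₂, hball₂, hle₂⟩ := exists_finset_forall_le_two_mul_norm ψ hψ
  refine ⟨N₁ ×ˢ N₂, ?_, fun p hp => ?_, fun B c hB u v => ?_⟩
  · rw [Finset.card_product, pow_add]
    exact Nat.mul_le_mul hcard₁ hcard₂
  · rw [Finset.mem_product] at hp
    exact ⟨hball₁ _ hp.1, hball₂ _ hp.2⟩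
  · have hnet : ∀ u ∈ N₁, B.flip v u ≤ 2 * c * ‖ψ v‖ := fun u hu =>
      hle₂ (B u) c (fun w hw => hB (u, w) (Finset.mem_product.mpr ⟨hu, hw⟩)) v
    calc B u v ≤ 2 * (2 * c * ‖ψ v‖) * ‖φ u‖ := hle₁ (B.flip v) _ hnet u
      _ = 4 * c * (‖φ u‖ * ‖ψ v‖) := by ring

end Nets

section Norms

theorem exists_eq_vecMulVec_of_rank_le_one {m n : Type*} [Finite m] [Fintype n]
    {Y : Matrix m n ℝ} (hY : Y.rank ≤ 1) : ∃ u v, Y = Matrix.vecMulVec u v := by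
  have := Fintype.ofFinite m
  rcases eq_or_ne Y 0 with rfl | h0
  · exact ⟨0, 0, by simp⟩
  · obtain ⟨i, j, hij⟩ : ∃ i j, Y i j ≠ 0 := by
      by_contra! h
      exact h0 (Matrix.ext h)
    refine ⟨fun i' => Y i' j / Y i j, Y i, Matrix.ext fun i' j' => ?_⟩
    rw [Matrix.vecMulVec_apply, div_mul_eq_mul_div, eq_div_iff hij,
      (rank_le_one_iff_minors Y).mp hY i' i j' j]

variable {m n : Type*} [Fintype m] [Fintype n]

theorem frobSq_nonneg (X : Matrix m n ℝ) : 0 ≤ frobSq X :=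
  Finset.sum_nonneg fun _ _ => Finset.sum_nonneg fun _ _ => sq_nonneg _

/-- The Frobenius inner product of two real matrices. -/
def frobInner (X Y : Matrix m n ℝ) : ℝ := ∑ i, ∑ j, X i j * Y i j

theorem frobInner_self (X : Matrix m n ℝ) : frobInner X X = frobSq X := by
  simp only [frobInner, frobSq, sq]

theorem frobSq_sub (X Y : Matrix m n ℝ) :
    frobSq (X - Y) = frobSq X - 2 * frobInner X Y + frobSq Y := by
  simp only [frobSq, frobInner, Finset.mul_sum, ← Finset.sum_sub_distrib,
    ← Finset.sum_add_distrib, Matrix.sub_apply]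
  exact Finset.sum_congr rfl fun i _ => Finset.sum_congr rfl fun j _ => by ring

theorem frobSq_vecMulVec (u : m → ℝ) (v : n → ℝ) :
    frobSq (Matrix.vecMulVec u v) = (∑ i, u i ^ 2) * ∑ j, v j ^ 2 := by
  simp only [frobSq, Matrix.vecMulVec_apply, mul_pow, Finset.sum_mul_sum]

theorem frobInner_vecMulVec (X : Matrix m n ℝ) (u : m → ℝ) (v : n → ℝ) :
    frobInner X (Matrix.vecMulVec u v) = ∑ i, u i * X.mulVec v i := by
  simp only [frobInner, Matrix.vecMulVec_apply, Matrix.mulVec, dotProduct, Finset.mul_sum]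
  exact Finset.sum_congr rfl fun i _ => Finset.sum_congr rfl fun j _ => mul_left_comm _ _ _

section Frobenius

open scoped Matrix.Norms.Frobenius

theorem frobenius_norm_sq (X : Matrix m n ℝ) : ‖X‖ ^ 2 = frobSq X := by
  rw [Matrix.frobenius_norm_def, ← Real.sqrt_eq_rpow, Real.sq_sqrt (by positivity)]
  simp only [frobSq, Real.rpow_two, Real.norm_eq_abs, sq_abs]

end Frobenius

section OpNorm

variable [DecidableEq n]

theorem opNorm_add_le (X Y : Matrix m n ℝ) : opNorm (X + Y) ≤ opNorm X + opNorm Y := by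
  rw [opNorm, map_add, map_add]
  exact norm_add_le _ _

theorem opNorm_add_sq_le (X Y : Matrix m n ℝ) {ε : ℝ} (hε : 0 < ε) :
    opNorm (X + Y) ^ 2 ≤ (1 + ε) * opNorm X ^ 2 + (1 + ε⁻¹) * opNorm Y ^ 2 :=
  calc opNorm (X + Y) ^ 2 ≤ (opNorm X + opNorm Y) ^ 2 :=
        pow_le_pow_left₀ (norm_nonneg _) (opNorm_add_le X Y) 2
    _ = opNorm X ^ 2 + 2 * opNorm X * opNorm Y + opNorm Y ^ 2 := add_sq _ _
    _ ≤ opNorm X ^ 2 + (ε * opNorm X ^ 2 + ε⁻¹ * opNorm Y ^ 2) + opNorm Y ^ 2 := by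
        gcongr; exact two_mul_le_add_mul_sq hε
    _ = _ := by ring

theorem sum_mulVec_sq_le (X : Matrix m n ℝ) (v : n → ℝ) :
    ∑ i, X.mulVec v i ^ 2 ≤ opNorm X ^ 2 * ∑ j, v j ^ 2 := by
  have h := pow_le_pow_left₀ (norm_nonneg _)
    ((LinearMap.toContinuousLinearMap (Matrix.toEuclideanLin X)).le_opNorm (WithLp.toLp 2 v)) 2
  rwa [mul_pow, EuclideanSpace.real_norm_sq_eq, EuclideanSpace.real_norm_sq_eq] at h

theorem exists_sum_mulVec_sq_eq (X : Matrix m n ℝ) :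
    ∃ v : n → ℝ, ∑ j, v j ^ 2 ≤ 1 ∧ ∑ i, X.mulVec v i ^ 2 = opNorm X ^ 2 := by
  let f := LinearMap.toContinuousLinearMap (Matrix.toEuclideanLin X)
  obtain ⟨x, hx, hmax⟩ := (isCompact_closedBall (0 : EuclideanSpace ℝ n) 1).exists_isMaxOn
    ⟨0, by simp⟩ (f := fun x => ‖f x‖) (by fun_prop)
  rw [mem_closedBall_zero_iff] at hx
  have hle : ‖f‖ ≤ ‖f x‖ := f.opNorm_le_of_unit_norm (norm_nonneg _) fun z hz => hmax (by simp [hz])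
  have heq : ‖f x‖ = ‖f‖ := (f.unit_le_opNorm x hx).antisymm hle
  refine ⟨x, ?_, ?_⟩
  · rw [← EuclideanSpace.real_norm_sq_eq]
    exact pow_le_one₀ (norm_nonneg _) hx
  · rw [opNorm, ← heq, EuclideanSpace.real_norm_sq_eq]
    rfl

theorem opNorm_sq_le_frobSq (X : Matrix m n ℝ) : opNorm X ^ 2 ≤ frobSq X := by
  obtain ⟨v, hv, h⟩ := exists_sum_mulVec_sq_eq X
  rw [← h]
  exact Finset.sum_le_sum fun i _ => (Finset.sum_mul_sq_le_sq_mul_sq _ _ _).trans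
    (mul_le_of_le_one_right (Finset.sum_nonneg fun _ _ => sq_nonneg _) hv)

theorem frobInner_vecMulVec_sq_le (X : Matrix m n ℝ) (u : m → ℝ) (v : n → ℝ) :
    frobInner X (Matrix.vecMulVec u v) ^ 2 ≤
      opNorm X ^ 2 * frobSq (Matrix.vecMulVec u v) := by
  rw [frobInner_vecMulVec, frobSq_vecMulVec]
  calc _ ≤ (∑ i, u i ^ 2) * ∑ i, X.mulVec v i ^ 2 := Finset.sum_mul_sq_le_sq_mul_sq _ _ _
    _ ≤ (∑ i, u i ^ 2) * (opNorm X ^ 2 * ∑ j, v j ^ 2) := by gcongr; exact sum_mulVec_sq_le X v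
    _ = _ := by ring

theorem frobSq_sub_opNorm_sq_le (X : Matrix m n ℝ) {Y : Matrix m n ℝ} (hY : Y.rank ≤ 1) :
    frobSq X - opNorm X ^ 2 ≤ frobSq (X - Y) := by
  obtain ⟨u, v, rfl⟩ := exists_eq_vecMulVec_of_rank_le_one hY
  have h0 := frobSq_nonneg (Matrix.vecMulVec u v)
  have hle : 2 * frobInner X (Matrix.vecMulVec u v) ≤
      opNorm X ^ 2 + frobSq (Matrix.vecMulVec u v) := by
    refine le_of_sq_le_sq ?_ (by positivity)
    nlinarith [frobInner_vecMulVec_sq_le X u v,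
      sq_nonneg (opNorm X ^ 2 - frobSq (Matrix.vecMulVec u v))]
  linarith [frobSq_sub X (Matrix.vecMulVec u v)]

end OpNorm
end Norms

section Blocks

variable {n K : ℕ} (Z : Clustering n K)

theorem sum_sum_community (f : Fin n → ℝ) : ∑ k, ∑ i : Community Z k, f i.1 = ∑ i, f i :=
  Fintype.sum_fiberwise (g := Z) (f := f)

theorem sum_frobSq_block (B : Matrix (Fin n) (Fin n) ℝ) :
    ∑ k, ∑ l, frobSq (block Z B k l) = frobSq B := by
  have hrow : ∀ k, ∑ l, frobSq (block Z B k l) = ∑ i : Community Z k, ∑ j, B i.1 j ^ 2 := by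
    intro k
    simp only [frobSq, block, Matrix.submatrix_apply]
    rw [Finset.sum_comm]
    exact Finset.sum_congr rfl fun i _ => sum_sum_community Z fun j => B i.1 j ^ 2
  simp only [hrow]
  exact sum_sum_community Z fun i => ∑ j, B i j ^ 2

/-- The sum over the blocks of the squared spectral norms, the size of `B` that the separation
condition compares with the squared Frobenius norm. -/
def opSq (B : Matrix (Fin n) (Fin n) ℝ) : ℝ := ∑ k, ∑ l, opNorm (block Z B k l) ^ 2

theorem opSq_nonneg (B : Matrix (Fin n) (Fin n) ℝ) : 0 ≤ opSq Z B :=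
  Finset.sum_nonneg fun _ _ => Finset.sum_nonneg fun _ _ => sq_nonneg _

theorem opSq_le_frobSq (B : Matrix (Fin n) (Fin n) ℝ) : opSq Z B ≤ frobSq B := by
  rw [← sum_frobSq_block Z B]
  exact Finset.sum_le_sum fun _ _ => Finset.sum_le_sum fun _ _ => opNorm_sq_le_frobSq _

theorem opSq_add_le (B C : Matrix (Fin n) (Fin n) ℝ) {ε : ℝ} (hε : 0 < ε) :
    opSq Z (B + C) ≤ (1 + ε) * opSq Z B + (1 + ε⁻¹) * opSq Z C := by
  simp only [opSq, Finset.mul_sum, ← Finset.sum_add_distrib]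
  exact Finset.sum_le_sum fun k _ => Finset.sum_le_sum fun l _ =>
    opNorm_add_sq_le (block Z B k l) (block Z C k l) hε

/-- The matrix whose `(k, l)` block is the outer product of the restriction of column `l` of `U`
to community `k` and the restriction of column `k` of `V` to community `l`. -/
def pairMatrix (U V : Matrix (Fin n) (Fin K) ℝ) : Matrix (Fin n) (Fin n) ℝ :=
  Matrix.of fun i j => U i (Z j) * V j (Z i)

/-- The bilinear form `(U, V) ↦ ⟨X, pairMatrix Z U V⟩`. With the Frobenius norm of `U` and the
largest Euclidean norm of a segment of `V` at most one, its supremum is `√(opSq Z X)`. -/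
def pairForm (X : Matrix (Fin n) (Fin n) ℝ) :
    Matrix (Fin n) (Fin K) ℝ →ₗ[ℝ] Matrix (Fin n) (Fin K) ℝ →ₗ[ℝ] ℝ :=
  LinearMap.mk₂ ℝ (fun U V => frobInner X (pairMatrix Z U V))
    (fun U U' V => by
      simp only [frobInner, pairMatrix, Matrix.of_apply, Matrix.add_apply, add_mul, mul_add,
        Finset.sum_add_distrib])
    (fun a U V => by
      simp only [frobInner, pairMatrix, Matrix.of_apply, Matrix.smul_apply, smul_eq_mul,
        Finset.mul_sum, mul_assoc, mul_left_comm a])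
    (fun U V V' => by
      simp only [frobInner, pairMatrix, Matrix.of_apply, Matrix.add_apply, mul_add,
        Finset.sum_add_distrib])
    (fun a U V => by
      simp only [frobInner, pairMatrix, Matrix.of_apply, Matrix.smul_apply, smul_eq_mul,
        Finset.mul_sum, mul_left_comm a])

/-- The partial contraction of `pairForm Z X` with `V`: its `(k, l)` part is the product of the
`(k, l)` block of `X` with the restriction of column `k` of `V` to community `l`. -/
def contract (X : Matrix (Fin n) (Fin n) ℝ) (V : Matrix (Fin n) (Fin K) ℝ) :
    Matrix (Fin n) (Fin K) ℝ :=
  Matrix.of fun i l => ∑ j : Community Z l, X i j.1 * V j.1 (Z i)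

/-- The restrictions of the columns of `V` to the communities. The product norm of this family is
the largest of their Euclidean norms. -/
def segments : Matrix (Fin n) (Fin K) ℝ →ₗ[ℝ]
    ((l : Fin K) → Fin K → EuclideanSpace ℝ (Community Z l)) where
  toFun V _ k := WithLp.toLp 2 fun j => V j.1 k
  map_add' _ _ := rfl
  map_smul' _ _ := rfl

theorem segments_injective : Function.Injective (segments Z) := fun _ _ h =>
  Matrix.ext fun i k => congrArg (fun s : EuclideanSpace ℝ (Community Z (Z i)) => s ⟨i, rfl⟩)
    (congrFun (congrFun h (Z i)) k)

theorem norm_segments_apply_sq (V : Matrix (Fin n) (Fin K) ℝ) (k l : Fin K) :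
    ‖segments Z V l k‖ ^ 2 = ∑ j : Community Z l, V j.1 k ^ 2 :=
  EuclideanSpace.real_norm_sq_eq _

theorem sum_sq_le_norm_segments_sq (V : Matrix (Fin n) (Fin K) ℝ) (k l : Fin K) :
    ∑ j : Community Z l, V j.1 k ^ 2 ≤ ‖segments Z V‖ ^ 2 := by
  rw [← norm_segments_apply_sq]
  gcongr
  exact (norm_le_pi_norm (segments Z V l) k).trans (norm_le_pi_norm (segments Z V) l)

theorem norm_segments_le {V : Matrix (Fin n) (Fin K) ℝ} {c : ℝ} (hc : 0 ≤ c)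
    (hV : ∀ k l, ∑ j : Community Z l, V j.1 k ^ 2 ≤ c ^ 2) : ‖segments Z V‖ ≤ c := by
  refine (pi_norm_le_iff_of_nonneg hc).mpr fun l => (pi_norm_le_iff_of_nonneg hc).mpr fun k => ?_
  exact le_of_sq_le_sq ((norm_segments_apply_sq Z V k l).trans_le (hV k l)) hc

theorem frobSq_pairMatrix_le (U V : Matrix (Fin n) (Fin K) ℝ) :
    frobSq (pairMatrix Z U V) ≤ frobSq U * ‖segments Z V‖ ^ 2 := by
  simp only [frobSq, pairMatrix, Matrix.of_apply, mul_pow, Finset.sum_mul]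
  refine Finset.sum_le_sum fun i _ => ?_
  rw [← sum_sum_community Z]
  refine Finset.sum_le_sum fun l _ => ?_
  calc ∑ j : Community Z l, U i (Z j.1) ^ 2 * V j.1 (Z i) ^ 2
      = U i l ^ 2 * ∑ j : Community Z l, V j.1 (Z i) ^ 2 := by
        rw [Finset.mul_sum]
        exact Finset.sum_congr rfl fun j _ => by rw [j.2]
    _ ≤ U i l ^ 2 * ‖segments Z V‖ ^ 2 := by
        gcongr; exact sum_sq_le_norm_segments_sq Z V (Z i) l

theorem pairForm_eq_frobInner_contract (X : Matrix (Fin n) (Fin n) ℝ)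
    (U V : Matrix (Fin n) (Fin K) ℝ) : pairForm Z X U V = frobInner U (contract Z X V) := by
  change frobInner X (pairMatrix Z U V) = _
  simp only [frobInner]
  refine Finset.sum_congr rfl fun i _ => ?_
  rw [← sum_sum_community Z]
  refine Finset.sum_congr rfl fun l _ => ?_
  simp only [contract, pairMatrix, Matrix.of_apply, Finset.mul_sum]
  exact Finset.sum_congr rfl fun j _ => by rw [j.2, mul_left_comm]

theorem frobSq_contract (X : Matrix (Fin n) (Fin n) ℝ) (V : Matrix (Fin n) (Fin K) ℝ) :
    frobSq (contract Z X V) =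
      ∑ k, ∑ l, ∑ i, (block Z X k l).mulVec (fun j => V j.1 k) i ^ 2 := by
  rw [frobSq, ← sum_sum_community Z]
  refine Finset.sum_congr rfl fun k _ => ?_
  rw [Finset.sum_comm]
  refine Finset.sum_congr rfl fun l _ => Finset.sum_congr rfl fun i _ => ?_
  simp only [contract, Matrix.of_apply, Matrix.mulVec, dotProduct, block, Matrix.submatrix_apply,
    i.2]

theorem exists_frobSq_contract_eq_opSq (X : Matrix (Fin n) (Fin n) ℝ) :
    ∃ V, ‖segments Z V‖ ≤ 1 ∧ frobSq (contract Z X V) = opSq Z X := by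
  choose v hv heq using fun k l => exists_sum_mulVec_sq_eq (block Z X k l)
  let V : Matrix (Fin n) (Fin K) ℝ := Matrix.of fun j k => v k (Z j) ⟨j, rfl⟩
  have hV : ∀ k l, (fun j : Community Z l => V j.1 k) = v k l := fun k l => by
    ext ⟨j, rfl⟩
    rfl
  refine ⟨V, norm_segments_le Z zero_le_one fun k l => ?_, ?_⟩
  · simpa only [← hV, one_pow] using hv k l
  · simp only [frobSq_contract, hV, heq, opSq]

end Blocks

section Support

variable {m n : Type*}

/-- The matrices whose entries outside `J` vanish, as a subspace whose unit balls carry the nets. -/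
def supportedOn (J : Finset (m × n)) : Submodule ℝ (Matrix m n ℝ) where
  carrier := {U | ∀ i l, (i, l) ∉ J → U i l = 0}
  zero_mem' _ _ _ := rfl
  add_mem' hU hV i l h := by rw [Matrix.add_apply, hU i l h, hV i l h, add_zero]
  smul_mem' a U hU i l h := by rw [Matrix.smul_apply, hU i l h, smul_zero]

theorem finrank_supportedOn_le (J : Finset (m × n)) :
    Module.finrank ℝ (supportedOn J) ≤ J.card := by
  let e : supportedOn J →ₗ[ℝ] J → ℝ :=
    { toFun U p := U.1 p.1.1 p.1.2
      map_add' _ _ := rfl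
      map_smul' _ _ := rfl }
  have he : Function.Injective e := fun U V h => Subtype.ext <| Matrix.ext fun i l => by
    by_cases hp : (i, l) ∈ J
    · exact congrFun h ⟨(i, l), hp⟩
    · rw [U.2 i l hp, V.2 i l hp]
  simpa using LinearMap.finrank_le_finrank_of_injective he

end Support

section TestMatrices

variable {n K : ℕ} (Z : Clustering n K) {J : Finset (Fin n × Fin K)}
  {X : Matrix (Fin n) (Fin n) ℝ}

theorem contract_mem_supportedOn (hX : ∀ i j, X i j ≠ 0 → (i, Z j) ∈ J)
    (V : Matrix (Fin n) (Fin K) ℝ) : contract Z X V ∈ supportedOn J := by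
  rintro i l hil
  rw [contract, Matrix.of_apply]
  refine Finset.sum_eq_zero ?_
  rintro ⟨j, rfl⟩ _
  rw [not_not.mp (mt (hX i j) hil), zero_mul]

theorem exists_mem_supportedOn_contract_eq (hX : ∀ i j, X i j ≠ 0 → (j, Z i) ∈ J)
    (V : Matrix (Fin n) (Fin K) ℝ) :
    ∃ V' ∈ supportedOn J, ‖segments Z V'‖ ≤ ‖segments Z V‖ ∧
      contract Z X V' = contract Z X V := by
  classical
  refine ⟨Matrix.of fun j k => if (j, k) ∈ J then V j k else 0, fun j k h => if_neg h,
    norm_segments_le Z (norm_nonneg _) fun k l => ?_, Matrix.ext fun i l => ?_⟩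
  · refine (Finset.sum_le_sum fun j _ => ?_).trans (sum_sq_le_norm_segments_sq Z V k l)
    rw [Matrix.of_apply]
    split_ifs
    · exact le_rfl
    · simpa using sq_nonneg (V j.1 k)
  · simp only [contract, Matrix.of_apply]
    refine Finset.sum_congr rfl fun j _ => ?_
    by_cases h : X i j.1 = 0
    · simp only [h, zero_mul]
    · rw [if_pos (hX i j.1 h)]

theorem exists_pairForm_eq_opSq (hrow : ∀ i j, X i j ≠ 0 → (i, Z j) ∈ J)
    (hcol : ∀ i j, X i j ≠ 0 → (j, Z i) ∈ J) :
    ∃ U ∈ supportedOn J, ∃ V ∈ supportedOn J, frobSq U = opSq Z X ∧ ‖segments Z V‖ ≤ 1 ∧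
      pairForm Z X U V = opSq Z X := by
  obtain ⟨V₀, hV₀, hop⟩ := exists_frobSq_contract_eq_opSq Z X
  obtain ⟨V, hVJ, hV, hcontract⟩ := exists_mem_supportedOn_contract_eq Z hcol V₀
  refine ⟨contract Z X V₀, contract_mem_supportedOn Z hrow V₀, V, hVJ, hop, hV.trans hV₀, ?_⟩
  rw [pairForm_eq_frobInner_contract, hcontract, frobInner_self, hop]

open scoped Matrix.Norms.Frobenius in
theorem exists_test_matrices (J : Finset (Fin n × Fin K)) :
    ∃ T : Finset (Matrix (Fin n) (Fin n) ℝ), T.card ≤ 25 ^ J.card ∧ (∀ M ∈ T, frobSq M ≤ 1) ∧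
      ∀ (X : Matrix (Fin n) (Fin n) ℝ) (s : ℝ),
        (∀ i j, X i j ≠ 0 → (i, Z j) ∈ J) → (∀ i j, X i j ≠ 0 → (j, Z i) ∈ J) →
        (∀ M ∈ T, frobInner X M ≤ s) → opSq Z X ≤ 16 * s ^ 2 := by
  classical
  let W := supportedOn J
  obtain ⟨N, hcard, hball, hnet⟩ := exists_finset_forall_bilin_le_four_mul_norm
    W.subtype W.injective_subtype (segments Z ∘ₗ W.subtype)
    ((segments_injective Z).comp W.injective_subtype)
  refine ⟨N.image fun p => pairMatrix Z p.1 p.2, ?_, ?_, fun X s hrow hcol hs => ?_⟩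
  · calc _ ≤ 5 ^ (Module.finrank ℝ W + Module.finrank ℝ W) := Finset.card_image_le.trans hcard
      _ ≤ 5 ^ (2 * J.card) := by
        have hdim : Module.finrank ℝ W ≤ J.card := finrank_supportedOn_le J
        gcongr <;> omega
      _ = 25 ^ J.card := by rw [pow_mul]; norm_num
  · simp only [Finset.forall_mem_image]
    rintro ⟨U, V⟩ hp
    obtain ⟨hU, hV⟩ := hball _ hp
    calc _ ≤ frobSq U.1 * ‖segments Z V.1‖ ^ 2 := frobSq_pairMatrix_le Z _ _
      _ ≤ 1 := by
        rw [← frobenius_norm_sq, ← mul_pow]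
        exact pow_le_one₀ (by positivity) (mul_le_one₀ hU (norm_nonneg _) hV)
  · obtain ⟨U, hU, V, hV, hfrob, hseg, heq⟩ := exists_pairForm_eq_opSq Z hrow hcol
    have hle : pairForm Z X U V ≤ 4 * s * (‖U‖ * ‖segments Z V‖) :=
      hnet ((pairForm Z X).domRestrict₁₂ W W) s
        (fun p hp => hs _ (Finset.mem_image_of_mem _ hp)) ⟨U, hU⟩ ⟨V, hV⟩
    rw [← frobenius_norm_sq] at hfrob
    rw [heq, ← hfrob] at hle
    rw [← hfrob]
    nlinarith [sq_nonneg (‖U‖ - 4 * s * ‖segments Z V‖), norm_nonneg (segments Z V),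
      mul_nonneg (sq_nonneg s) (sub_nonneg.mpr (pow_le_one₀ (n := 2) (norm_nonneg _) hseg))]

end TestMatrices

section UpperTriangle

variable {ι : Type*} [LinearOrder ι]

/-- The position on or above the diagonal that carries the same entry of a symmetric matrix. -/
def sortPair (q : ι × ι) : {p : ι × ι // p.1 ≤ p.2} :=
  ⟨(min q.1 q.2, max q.1 q.2), min_le_max⟩

theorem apply_sortPair {X : Matrix ι ι ℝ} (hX : ∀ i j, X i j = X j i) (q : ι × ι) :
    X (sortPair q).1.1 (sortPair q).1.2 = X q.1 q.2 := by
  rcases le_total q.1 q.2 with h | h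
  · simp only [sortPair, min_eq_left h, max_eq_right h]
  · simp only [sortPair, min_eq_right h, max_eq_left h, hX q.2]

variable [Fintype ι]

theorem card_filter_sortPair_eq_le (p : {p : ι × ι // p.1 ≤ p.2}) :
    (Finset.univ.filter fun q => sortPair q = p).card ≤ 2 := by
  refine (Finset.card_le_card fun q hq => ?_).trans (Finset.card_le_two (a := p.1) (b := p.1.swap))
  rw [← (Finset.mem_filter.mp hq).2, Finset.mem_insert, Finset.mem_singleton]
  rcases le_total q.1 q.2 with h | h
  · left
    simp only [sortPair, min_eq_left h, max_eq_right h]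
  · right
    simp only [sortPair, min_eq_right h, max_eq_left h, Prod.swap_prod_mk]

/-- The coefficients of `X ↦ ⟨X, M⟩`, as a linear form in the entries of a symmetric matrix `X` on
and above the diagonal. -/
def foldUpper (M : Matrix ι ι ℝ) (p : {p : ι × ι // p.1 ≤ p.2}) : ℝ :=
  ∑ q with sortPair q = p, M q.1 q.2

theorem frobInner_eq_sum_foldUpper {X : Matrix ι ι ℝ} (hX : ∀ i j, X i j = X j i)
    (M : Matrix ι ι ℝ) : frobInner X M = ∑ p, foldUpper M p * X p.1.1 p.1.2 := by
  rw [frobInner, ← Fintype.sum_prod_type' (fun i j => X i j * M i j),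
    ← Finset.sum_fiberwise _ sortPair]
  refine Finset.sum_congr rfl fun p _ => ?_
  rw [foldUpper, Finset.sum_mul]
  refine Finset.sum_congr rfl fun q hq => ?_
  rw [← (Finset.mem_filter.mp hq).2, apply_sortPair hX, mul_comm]

theorem sum_foldUpper_sq_le (M : Matrix ι ι ℝ) : ∑ p, foldUpper M p ^ 2 ≤ 2 * frobSq M := by
  rw [frobSq, ← Fintype.sum_prod_type' (fun i j => M i j ^ 2),
    ← Finset.sum_fiberwise _ sortPair, Finset.mul_sum]
  refine Finset.sum_le_sum fun p _ => sq_sum_le_card_mul_sum_sq.trans ?_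
  gcongr
  exact_mod_cast card_filter_sortPair_eq_le p

end UpperTriangle

section Concentration

variable {ι Ω : Type*} [MeasurableSpace Ω] {μ : Measure Ω}

/-- The entrywise expectation of a random matrix. -/
def meanMatrix (μ : Measure Ω) (A : Ω → Matrix ι ι ℝ) : Matrix ι ι ℝ :=
  Matrix.of fun i j => ∫ ω, A ω i j ∂μ

theorem measureReal_exists_mem_le {α β : Type*} [Fintype α] {T : α → Finset β}
    {E : α → β → Set Ω} {t : ℝ}
    (hE : ∀ a, ∀ b ∈ T a, μ.real (E a b) ≤
      Real.exp (-(Real.log (T a).card + (Real.log (Fintype.card α) + t)))) :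
    μ.real {ω | ∃ a, ∃ b ∈ T a, ω ∈ E a b} ≤ Real.exp (-t) := by
  have hcount : ∀ (N : ℕ) (s : ℝ), N * Real.exp (-(Real.log N + s)) ≤ Real.exp (-s) := by
    intro N s
    rcases N.eq_zero_or_pos with rfl | hN
    · simpa using (Real.exp_pos (-s)).le
    · have hN' : (0 : ℝ) < N := by exact_mod_cast hN
      rw [neg_add, Real.exp_add, Real.exp_neg, Real.exp_log hN', mul_inv_cancel_left₀ hN'.ne']
  have hunion : ∀ a, μ.real (⋃ b ∈ T a, E a b) ≤
      Real.exp (-(Real.log (Fintype.card α) + t)) := fun a =>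
    calc _ ≤ ∑ b ∈ T a, μ.real (E a b) := measureReal_biUnion_finset_le _ _
      _ ≤ (T a).card * Real.exp (-(Real.log (T a).card + (Real.log (Fintype.card α) + t))) := by
        simpa only [nsmul_eq_mul] using Finset.sum_le_card_nsmul _ _ _ (hE a)
      _ ≤ _ := hcount _ _
  calc μ.real {ω | ∃ a, ∃ b ∈ T a, ω ∈ E a b} = μ.real (⋃ a, ⋃ b ∈ T a, E a b) := by
        congr 1; ext ω; simp
    _ ≤ ∑ a, μ.real (⋃ b ∈ T a, E a b) := measureReal_iUnion_fintype_le _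
    _ ≤ Fintype.card α * Real.exp (-(Real.log (Fintype.card α) + t)) := by
        simpa only [nsmul_eq_mul, Finset.card_univ] using
          Finset.sum_le_card_nsmul Finset.univ _ _ fun a _ => hunion a
    _ ≤ _ := hcount _ _

variable [IsProbabilityMeasure μ]

theorem one_sub_add_le_measureReal {s t g : Set Ω} (h : ∀ᵐ ω ∂μ, ω ∉ s → ω ∉ t → ω ∈ g) :
    1 - (μ.real s + μ.real t) ≤ μ.real g := by
  have hcover : ∀ᵐ ω ∂μ, ω ∈ s ∪ t ∪ g := by
    filter_upwards [h] with ω hω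
    by_cases hs : ω ∈ s
    · exact Or.inl (Or.inl hs)
    · by_cases ht : ω ∈ t
      · exact Or.inl (Or.inr ht)
      · exact Or.inr (hω hs ht)
  have hone : μ.real (s ∪ t ∪ g) = 1 :=
    (measureReal_congr (Filter.eventuallyEq_univ.mpr hcover)).trans probReal_univ
  linarith [measureReal_union_le (μ := μ) (s ∪ t) g, measureReal_union_le (μ := μ) s t]

variable [LinearOrder ι] [Fintype ι] {A : Ω → Matrix ι ι ℝ}

theorem hasSubgaussianMGF_frobInner_sub_meanMatrix
    (hmeas : ∀ i j, AEMeasurable (fun ω => A ω i j) μ)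
    (hIcc : ∀ i j, ∀ᵐ ω ∂μ, A ω i j ∈ Set.Icc (0 : ℝ) 1) (hsymm : ∀ ω i j, A ω i j = A ω j i)
    (hindep : iIndepFun (fun (p : {p : ι × ι // p.1 ≤ p.2}) ω => A ω p.1.1 p.1.2) μ)
    (M : Matrix ι ι ℝ) :
    ∃ c : NNReal, (c : ℝ) ≤ frobSq M / 2 ∧
      HasSubgaussianMGF (fun ω => frobInner (A ω - meanMatrix μ A) M) c μ := by
  have hsum : ∀ ω, frobInner (A ω - meanMatrix μ A) M =
      ∑ p, foldUpper M p * (A ω p.1.1 p.1.2 - ∫ ω, A ω p.1.1 p.1.2 ∂μ) := fun ω =>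
    frobInner_eq_sum_foldUpper (X := A ω - meanMatrix μ A)
      (fun i j => by simp only [Matrix.sub_apply, meanMatrix, Matrix.of_apply, hsymm _ i j]) M
  let c (p : {p : ι × ι // p.1 ≤ p.2}) : NNReal :=
    NNReal.mk (foldUpper M p ^ 2) (sq_nonneg _) * (‖(1 : ℝ) - 0‖₊ / 2) ^ 2
  have hc : ∀ p, (c p : ℝ) = foldUpper M p ^ 2 * (1 / 4) := fun p => by
    rw [NNReal.coe_mul, NNReal.coe_mk]
    norm_num
  have hterm : ∀ p, HasSubgaussianMGF
      (fun ω => foldUpper M p * (A ω p.1.1 p.1.2 - ∫ ω, A ω p.1.1 p.1.2 ∂μ)) (c p) μ := fun p =>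
    (hasSubgaussianMGF_of_mem_Icc (hmeas p.1.1 p.1.2) (hIcc p.1.1 p.1.2)).const_mul _
  simp only [hsum]
  refine ⟨_, ?_, HasSubgaussianMGF.sum_of_iIndepFun (hindep.comp
    (fun p x => foldUpper M p * (x - ∫ ω, A ω p.1.1 p.1.2 ∂μ)) fun p => by fun_prop)
    (s := Finset.univ) fun p _ => hterm p⟩
  simp only [NNReal.coe_sum, hc, ← Finset.sum_mul]
  linarith [sum_foldUpper_sq_le M]

theorem measureReal_le_frobInner_sub_meanMatrix_le
    (hmeas : ∀ i j, AEMeasurable (fun ω => A ω i j) μ)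
    (hIcc : ∀ i j, ∀ᵐ ω ∂μ, A ω i j ∈ Set.Icc (0 : ℝ) 1) (hsymm : ∀ ω i j, A ω i j = A ω j i)
    (hindep : iIndepFun (fun (p : {p : ι × ι // p.1 ≤ p.2}) ω => A ω p.1.1 p.1.2) μ)
    (M : Matrix ι ι ℝ) {θ : ℝ} (hθ : 0 < θ) (t : ℝ) :
    μ.real {ω | θ / 4 * frobSq M + t / θ ≤ frobInner (A ω - meanMatrix μ A) M} ≤
      Real.exp (-t) := by
  obtain ⟨c, hc, hsub⟩ :=
    hasSubgaussianMGF_frobInner_sub_meanMatrix hmeas hIcc hsymm hindep M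
  refine (measure_ge_le_exp_mul_mgf _ hθ.le (hsub.integrable_exp_mul θ)).trans ?_
  refine (mul_le_mul_of_nonneg_left (hsub.mgf_le θ) (Real.exp_pos _).le).trans ?_
  rw [← Real.exp_add, Real.exp_le_exp, mul_add, neg_mul, neg_mul, mul_div_cancel₀ t hθ.ne']
  nlinarith [mul_le_mul_of_nonneg_right hc (sq_nonneg θ)]

end Concentration

section EntropyTerm

variable {N x : ℕ}

theorem entropyTerm_zero_right (N : ℕ) : entropyTerm N 0 = 0 := by
  rw [entropyTerm, Nat.cast_zero, zero_mul]

theorem entropyTerm_eq (hN : 0 < N) (hx : 0 < x) :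
    entropyTerm N x = x * (1 + Real.log N - Real.log x) := by
  have hN' : (N : ℝ) ≠ 0 := by positivity
  have hx' : (x : ℝ) ≠ 0 := by positivity
  rw [entropyTerm, Real.log_div (mul_ne_zero hN' (Real.exp_ne_zero 1)) hx',
    Real.log_mul hN' (Real.exp_ne_zero 1), Real.log_exp, add_comm 1]

theorem le_entropyTerm (h : x ≤ N) : (x : ℝ) ≤ entropyTerm N x := by
  rcases x.eq_zero_or_pos with rfl | hx
  · rw [entropyTerm_zero_right, Nat.cast_zero]
  · rw [entropyTerm_eq (hx.trans_le h) hx]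
    have hlog : Real.log x ≤ Real.log N := Real.log_le_log (by positivity) (by exact_mod_cast h)
    exact le_mul_of_one_le_right x.cast_nonneg (by linarith)

theorem entropyTerm_nonneg (h : x ≤ N) : 0 ≤ entropyTerm N x :=
  x.cast_nonneg.trans (le_entropyTerm h)

theorem log_le_entropyTerm (hx : 0 < x) (h : x ≤ N) : Real.log N ≤ entropyTerm N x := by
  have hx1 : (1 : ℝ) ≤ x := by exact_mod_cast hx
  have hlog : Real.log x ≤ Real.log N := Real.log_le_log (by positivity) (by exact_mod_cast h)
  have hlogx : Real.log x ≤ x - 1 := Real.log_le_sub_one_of_pos (by positivity)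
  rw [entropyTerm_eq (hx.trans_le h) hx]
  nlinarith

-- The right-hand side is the tangent of the concave function on the left at `x = r * N`.
theorem entropyTerm_le_mul_sub (h : x ≤ N) {r : ℝ} (hr : 0 < r) :
    entropyTerm N x ≤ r * N - x * Real.log r := by
  rcases x.eq_zero_or_pos with rfl | hx
  · rw [entropyTerm_zero_right, Nat.cast_zero, zero_mul, sub_zero]
    positivity
  · have hN := hx.trans_le h
    have hlog : Real.log (r * N / x) ≤ r * N / x - 1 :=
      Real.log_le_sub_one_of_pos (by positivity)
    rw [Real.log_div (by positivity) (by positivity), Real.log_mul hr.ne' (by positivity),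
      le_sub_iff_add_le, le_div_iff₀ (by positivity)] at hlog
    rw [entropyTerm_eq hN hx]
    linarith

theorem sum_entropyTerm_le {ι : Type*} (s : Finset ι) {N x : ι → ℕ} (h : ∀ i ∈ s, x i ≤ N i) :
    ∑ i ∈ s, entropyTerm (N i) (x i) ≤ entropyTerm (∑ i ∈ s, N i) (∑ i ∈ s, x i) := by
  rcases (∑ i ∈ s, x i).eq_zero_or_pos with hzero | hpos
  · have hx : ∀ i ∈ s, x i = 0 := Finset.sum_eq_zero_iff.mp hzero
    rw [hzero, entropyTerm_zero_right,
      Finset.sum_eq_zero fun i hi => by rw [hx i hi, entropyTerm_zero_right]]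
  · have hNpos : 0 < ∑ i ∈ s, N i := hpos.trans_le (Finset.sum_le_sum h)
    set a := ∑ i ∈ s, x i
    set b := ∑ i ∈ s, N i
    have ha' : (a : ℝ) ≠ 0 := by positivity
    have hb' : (b : ℝ) ≠ 0 := by positivity
    calc ∑ i ∈ s, entropyTerm (N i) (x i)
        ≤ ∑ i ∈ s, ((a / b : ℝ) * N i - x i * Real.log (a / b)) :=
          Finset.sum_le_sum fun i hi => entropyTerm_le_mul_sub (h i hi) (by positivity)
      _ = a / b * b - a * Real.log (a / b) := by
          rw [Finset.sum_sub_distrib, ← Finset.mul_sum, ← Finset.sum_mul, ← Nat.cast_sum,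
            ← Nat.cast_sum]
      _ = entropyTerm b a := by
          rw [entropyTerm_eq hNpos hpos, div_mul_cancel₀ _ hb', Real.log_div ha' hb']
          ring

end EntropyTerm

section Penalties

variable {n K : ℕ} (Z : Clustering n K) (J : Finset (Fin n × Fin K))

theorem card_le_mul : J.card ≤ n * K := by
  simpa using Finset.card_le_univ J

theorem card_part_le (k l : Fin K) : (part Z J k l).card ≤ commSize Z k :=
  Finset.card_le_univ _

theorem sum_commSize : ∑ k, commSize Z k = n := by
  simpa [commSize] using Fintype.card_congr (Equiv.sigmaFiberEquiv Z)

theorem sum_card_part : ∑ k, ∑ l, (part Z J k l).card = J.card := by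
  simp only [part, Finset.card_filter]
  rw [Finset.sum_congr rfl fun k _ => Finset.sum_comm,
    Fintype.sum_fiberwise (g := Z) (f := fun i => ∑ l, if (i, l) ∈ J then 1 else 0),
    ← Fintype.sum_prod_type' (fun i l => if (i, l) ∈ J then 1 else 0)]
  simp

theorem sum_entropyTerm_part_le :
    ∑ k, ∑ l, entropyTerm (commSize Z k) (part Z J k l).card ≤ entropyTerm (n * K) J.card := by
  have h := sum_entropyTerm_le Finset.univ (N := fun p : Fin K × Fin K => commSize Z p.1)
    (x := fun p => (part Z J p.1 p.2).card) fun p _ => card_part_le Z J _ _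
  simpa [Fintype.sum_prod_type, sum_card_part, ← Finset.mul_sum, sum_commSize, mul_comm] using h

variable {Z J} {β₁ β₂ : ℝ}

theorem penBase_le_sepPenalty (hβ₁ : 0 ≤ β₁) (hβ₂ : 0 ≤ β₂) :
    penBase β₂ n K ≤ sepPenalty β₁ β₂ Z J := by
  have hent : 0 ≤ ∑ k, ∑ l, entropyTerm (commSize Z k) (part Z J k l).card :=
    Finset.sum_nonneg fun k _ => Finset.sum_nonneg fun l _ =>
      entropyTerm_nonneg (card_part_le Z J k l)
  exact le_add_of_nonneg_left (by positivity)

theorem penBase_le_nonsepPenalty (hβ₁ : 0 ≤ β₁) (hβ₂ : 0 ≤ β₂) :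
    penBase β₂ n K ≤ nonsepPenalty β₁ β₂ Z J := by
  have hent := entropyTerm_nonneg (card_le_mul J)
  exact le_add_of_nonneg_left (by positivity)

theorem sepPenalty_le (hβ₁ : 0 ≤ β₁) (hβ₂ : 0 ≤ β₂) (hJ : ∀ k l, (part Z J k l).Nonempty) :
    sepPenalty β₁ β₂ Z J ≤ (β₁ + β₂) * entropyTerm (n * K) J.card + penBase β₂ n K := by
  have hlog : K * ∑ k, Real.log (commSize Z k) ≤
      ∑ k, ∑ l, entropyTerm (commSize Z k) (part Z J k l).card := by
    rw [Finset.mul_sum]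
    refine Finset.sum_le_sum fun k _ => ?_
    simpa using Finset.card_nsmul_le_sum Finset.univ _ _ fun l _ =>
      log_le_entropyTerm (Finset.card_pos.mpr (hJ k l)) (card_part_le Z J k l)
  have hsum := sum_entropyTerm_part_le Z J
  rw [sepPenalty, mul_assoc β₂, add_mul]
  gcongr
  exact hlog.trans hsum

theorem nonsepPenalty_le (hβ₂ : 0 ≤ β₂) (hJ : ∀ k l, (part Z J k l).Nonempty) :
    nonsepPenalty β₁ β₂ Z J ≤ (β₁ + 2 * β₂) * entropyTerm (n * K) J.card + penBase β₂ n K := by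
  have hlog : Real.log n ≤ entropyTerm (n * K) J.card := by
    rcases n.eq_zero_or_pos with rfl | hn
    · simpa using entropyTerm_nonneg (card_le_mul J)
    · obtain ⟨i, hi⟩ := hJ (Z ⟨0, hn⟩) (Z ⟨0, hn⟩)
      have hpos : 0 < J.card := Finset.card_pos.mpr ⟨_, (Finset.mem_filter.mp hi).2⟩
      refine le_trans (Real.log_le_log (by exact_mod_cast hn) ?_)
        (log_le_entropyTerm hpos (card_le_mul J))
      exact_mod_cast Nat.le_mul_of_pos_right n (Z ⟨0, hn⟩).pos
  rw [nonsepPenalty, add_mul]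
  gcongr

theorem penalty_le_add {Z' : Clustering n K} {J' : Finset (Fin n × Fin K)} (hβ₁ : 0 ≤ β₁)
    (hβ₂ : 0 ≤ β₂) (hJ : ∀ k l, (part Z J k l).Nonempty)
    {pen : Clustering n K → Finset (Fin n × Fin K) → ℝ}
    (hpen : pen = sepPenalty β₁ β₂ ∨ pen = nonsepPenalty β₁ β₂) :
    pen Z J ≤ pen Z' J' + (β₁ + 2 * β₂) * entropyTerm (n * K) J.card := by
  have hent := mul_nonneg hβ₂ (entropyTerm_nonneg (card_le_mul J))
  rcases hpen with rfl | rfl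
  · linarith [sepPenalty_le hβ₁ hβ₂ hJ, penBase_le_sepPenalty (Z := Z') (J := J') hβ₁ hβ₂]
  · linarith [nonsepPenalty_le (β₁ := β₁) hβ₂ hJ,
      penBase_le_nonsepPenalty (Z := Z') (J := J') hβ₁ hβ₂]

end Penalties

theorem part_supportSet_nonempty {n K : ℕ} {Z : Clustering n K} {L : Matrix (Fin n) (Fin K) ℝ}
    {k l : Fin K} (hL : (fun i : Community Z k => L i.1 l) ≠ 0) :
    (part Z (supportSet L) k l).Nonempty := by
  obtain ⟨i, hi⟩ := Function.ne_iff.mp hL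
  exact ⟨i, by simpa [part, supportSet] using hi⟩

section MeanMatrix

theorem frobInner_sub_left {m n : Type*} [Fintype m] [Fintype n] (X Y M : Matrix m n ℝ) :
    frobInner (X - Y) M = frobInner X M - frobInner Y M := by
  simp only [frobInner, Matrix.sub_apply, sub_mul, Finset.sum_sub_distrib]

theorem frobInner_neg_right {m n : Type*} [Fintype m] [Fintype n] (X M : Matrix m n ℝ) :
    frobInner X (-M) = -frobInner X M := by
  simp only [frobInner, Matrix.neg_apply, mul_neg, Finset.sum_neg_distrib]

theorem frobSq_neg {m n : Type*} [Fintype m] [Fintype n] (M : Matrix m n ℝ) :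
    frobSq (-M) = frobSq M := by
  simp only [frobSq, Matrix.neg_apply, neg_sq]

theorem frobInner_eq_frobSq_sub {m n : Type*} [Fintype m] [Fintype n] {M P : Matrix m n ℝ}
    (hM : ∀ i j, M i j = P i j ∨ M i j = 0) : frobInner M P = frobSq P - frobSq (M - P) := by
  simp only [frobInner, frobSq, ← Finset.sum_sub_distrib]
  refine Finset.sum_congr rfl fun i _ => Finset.sum_congr rfl fun j _ => ?_
  rw [Matrix.sub_apply]
  rcases hM i j with h | h <;> rw [h] <;> ring

variable {n K : ℕ} {Z : Clustering n K} {L : Matrix (Fin n) (Fin K) ℝ}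

theorem probMatrix_symm (Z : Clustering n K) (L : Matrix (Fin n) (Fin K) ℝ) (i j : Fin n) :
    probMatrix Z L i j = probMatrix Z L j i := mul_comm _ _

theorem sq_probMatrix_self_le (hL : ∀ i l, L i l ∈ Set.Icc (0 : ℝ) 1) (i : Fin n) :
    probMatrix Z L i i ^ 2 ≤ if L i (Z i) ≠ 0 then 1 else 0 := by
  obtain ⟨h0, h1⟩ := hL i (Z i)
  split_ifs with h
  · exact pow_le_one₀ (mul_nonneg h0 h0) (mul_le_one₀ h1 h0 h1)
  · rw [probMatrix, Matrix.of_apply, not_not.mp h]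
    norm_num

theorem frobSq_sub_probMatrix_le {M : Matrix (Fin n) (Fin n) ℝ}
    (hL : ∀ i l, L i l ∈ Set.Icc (0 : ℝ) 1)
    (hM : ∀ i j, M i j = probMatrix Z L i j ∨ i = j ∧ M i j = 0) :
    frobSq (M - probMatrix Z L) ≤ (supportSet L).card := by
  have hrow : ∀ i, ∑ j, (M - probMatrix Z L) i j ^ 2 ≤ if L i (Z i) ≠ 0 then 1 else 0 := by
    intro i
    rw [Finset.sum_eq_single i
      (fun j _ hj => by rw [Matrix.sub_apply, (hM i j).resolve_right fun h => hj h.1.symm]; ring)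
      (fun h => absurd (Finset.mem_univ i) h)]
    refine le_trans ?_ (sq_probMatrix_self_le hL i)
    rcases hM i i with h | ⟨-, h⟩ <;> rw [Matrix.sub_apply, h]
    · simpa using sq_nonneg _
    · rw [zero_sub, neg_sq]
  refine (Finset.sum_le_sum fun i _ => hrow i).trans ?_
  rw [Finset.sum_boole]
  exact_mod_cast Finset.card_le_card_of_injOn (fun i => (i, Z i))
    (fun i hi => by simpa [supportSet] using hi) fun i _ j _ hij => congrArg Prod.fst hij

end MeanMatrix

section Criterion

variable {n K : ℕ}

theorem frobSq_sub_opSq_add_le_criterion (pen : Clustering n K → Finset (Fin n × Fin K) → ℝ)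
    (A : Matrix (Fin n) (Fin n) ℝ) (Z : Clustering n K) (J : Finset (Fin n × Fin K)) :
    frobSq A - opSq Z A + pen Z J ≤ criterion pen A Z J := by
  rw [criterion, ← sum_frobSq_block Z A, opSq, ← Finset.sum_sub_distrib]
  gcongr with k
  rw [← Finset.sum_sub_distrib]
  exact Finset.sum_le_sum fun l _ => frobSq_sub_opNorm_sq_le _ (rankOneApprox_spec _).1

variable {pen : Clustering n K → Finset (Fin n × Fin K) → ℝ} {A : Matrix (Fin n) (Fin n) ℝ}
  {Z : Clustering n K} {L : Matrix (Fin n) (Fin K) ℝ}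

theorem rectProj_supportSet_block (hA : ∀ i j, probMatrix Z L i j = 0 → A i j = 0) (k l : Fin K) :
    rectProj (part Z (supportSet L) k l) (part Z (supportSet L) l k) (block Z A k l) =
      block Z A k l := by
  ext ⟨i, rfl⟩ ⟨j, rfl⟩
  simp only [rectProj, Matrix.of_apply, ite_eq_left_iff]
  refine fun h => (hA i j ?_).symm
  contrapose! h
  simpa [part, supportSet, probMatrix] using h

theorem rank_block_probMatrix_le_one (k l : Fin K) : (block Z (probMatrix Z L) k l).rank ≤ 1 := by
  rw [rank_le_one_iff_minors]
  rintro ⟨i, rfl⟩ ⟨i', hi'⟩ ⟨j, rfl⟩ ⟨j', hj'⟩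
  simp only [block, Matrix.submatrix_apply, probMatrix, Matrix.of_apply, hi', hj']
  ring

theorem criterion_supportSet_le (hA : ∀ i j, probMatrix Z L i j = 0 → A i j = 0) :
    criterion pen A Z (supportSet L) ≤ frobSq (A - probMatrix Z L) + pen Z (supportSet L) := by
  rw [criterion, ← sum_frobSq_block Z (A - probMatrix Z L)]
  gcongr with k _ l
  rw [rectProj_supportSet_block hA]
  exact (rankOneApprox_spec (block Z A k l)).2 _ (rank_block_probMatrix_le_one k l)

theorem IsSolution.frobSq_probMatrix_le {β₁ β₂ : ℝ} (hβ₁ : 0 ≤ β₁) (hβ₂ : 0 ≤ β₂)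
    (hpen : pen = sepPenalty β₁ β₂ ∨ pen = nonsepPenalty β₁ β₂)
    (hL : ∀ k l, (fun i : Community Z k => L i.1 l) ≠ 0)
    (hA : ∀ i j, probMatrix Z L i j = 0 → A i j = 0) {M : Matrix (Fin n) (Fin n) ℝ}
    (hM : ∀ i j, M i j = probMatrix Z L i j ∨ M i j = 0)
    {Zhat : Clustering n K} {Jhat : Finset (Fin n × Fin K)} (hsol : IsSolution pen A Zhat Jhat) :
    frobSq (probMatrix Z L) ≤ opSq Zhat A - 2 * frobInner (A - M) (probMatrix Z L)
      + 2 * frobSq (M - probMatrix Z L)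
      + (β₁ + 2 * β₂) * entropyTerm (n * K) (supportSet L).card := by
  have hpenalty := penalty_le_add (Z' := Zhat) (J' := Jhat) hβ₁ hβ₂
    (fun k l => part_supportSet_nonempty (hL k l)) hpen
  have hcrit := (frobSq_sub_opSq_add_le_criterion pen A Zhat Jhat).trans
    ((hsol Z (supportSet L)).trans (criterion_supportSet_le hA))
  rw [frobSq_sub] at hcrit
  linarith [frobInner_sub_left A M (probMatrix Z L), frobInner_eq_frobSq_sub hM]

end Criterion

section Consistency

variable {n K : ℕ}

theorem opSq_le_add_noise (Z : Clustering n K) (A M P : Matrix (Fin n) (Fin n) ℝ) {α : ℝ}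
    (hα : α ∈ Set.Ioc (0 : ℝ) 1) :
    opSq Z A ≤ (1 + α / 4) * opSq Z P
      + 5 / α * (2 * opSq Z (A - M) + 2 * frobSq (M - P)) := by
  obtain ⟨hα0, hα1⟩ := hα
  have hnoise : opSq Z (A - P) ≤ 2 * opSq Z (A - M) + 2 * frobSq (M - P) := by
    have h := opSq_add_le Z (A - M) (M - P) one_pos
    rw [sub_add_sub_cancel] at h
    linarith [opSq_le_frobSq Z (M - P)]
  have hcoef : 1 + (α / 4)⁻¹ ≤ 5 / α := by
    rw [inv_div, le_div_iff₀ hα0, add_mul, div_mul_cancel₀ _ hα0.ne']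
    linarith
  have h := opSq_add_le Z P (A - P) (show 0 < α / 4 by positivity)
  rw [add_sub_cancel] at h
  refine h.trans ?_
  gcongr
  exact opSq_nonneg Z _

theorem IsSolution.one_sub_mul_frobSq_le {β₁ β₂ : ℝ} (hβ₁ : 0 ≤ β₁) (hβ₂ : 0 ≤ β₂)
    {pen : Clustering n K → Finset (Fin n × Fin K) → ℝ}
    (hpen : pen = sepPenalty β₁ β₂ ∨ pen = nonsepPenalty β₁ β₂)
    {Z : Clustering n K} {L : Matrix (Fin n) (Fin K) ℝ}
    (hL : ∀ k l, (fun i : Community Z k => L i.1 l) ≠ 0) {A M : Matrix (Fin n) (Fin n) ℝ}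
    (hA : ∀ i j, probMatrix Z L i j = 0 → A i j = 0)
    (hM : ∀ i j, M i j = probMatrix Z L i j ∨ M i j = 0)
    {Zhat : Clustering n K} {Jhat : Finset (Fin n × Fin K)} (hsol : IsSolution pen A Zhat Jhat)
    {α R : ℝ} (hα : α ∈ Set.Ioc (0 : ℝ) 1) (hop : opSq Zhat (A - M) ≤ 64 * R)
    (hbias : frobSq (M - probMatrix Z L) ≤ R)
    (hlin : -frobInner (A - M) (probMatrix Z L) ≤ α / 8 * frobSq (probMatrix Z L) + 2 * (R / α)) :
    (1 - α / 4) * frobSq (probMatrix Z L) ≤ (1 + α / 4) * opSq Zhat (probMatrix Z L)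
      + 656 * (R / α) + (β₁ + 2 * β₂) * entropyTerm (n * K) (supportSet L).card := by
  obtain ⟨hα0, hα1⟩ := id hα
  have hnoise : 5 / α * (2 * opSq Zhat (A - M) + 2 * frobSq (M - probMatrix Z L)) ≤
      5 / α * (130 * R) :=
    mul_le_mul_of_nonneg_left (by linarith) (by positivity)
  have hR : R ≤ R / α := le_div_self ((frobSq_nonneg _).trans hbias) hα0 hα1
  have hscale : 5 / α * (130 * R) = 650 * (R / α) := by ring
  linarith [hsol.frobSq_probMatrix_le hβ₁ hβ₂ hpen hL hA hM,
    opSq_le_add_noise Zhat A M (probMatrix Z L) hα]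

theorem lt_of_separation {α F O R H : ℝ} (hα : α ∈ Set.Ioc (0 : ℝ) 1) (hO : 0 ≤ O) (hR : 0 < R)
    (hH : 0 ≤ H) (hsep : (1 + α) * O + 1000 * R + 2 * H ≤ F) :
    (1 + α / 4) * O + 656 * R + H < (1 - α / 4) * F := by
  obtain ⟨hα0, hα1⟩ := hα
  have hO' : (1 + α / 4) * O ≤ (1 - α / 4) * ((1 + α) * O) := by
    rw [← mul_assoc]
    gcongr
    nlinarith
  have hR' : 656 * R < (1 - α / 4) * (1000 * R) := by nlinarith
  have hH' : H ≤ (1 - α / 4) * (2 * H) := by nlinarith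
  calc _ < (1 - α / 4) * ((1 + α) * O + 1000 * R + 2 * H) := by linarith
    _ ≤ (1 - α / 4) * F := mul_le_mul_of_nonneg_left hsep (by linarith)

theorem IsSolution.misclustered_le {β₁ β₂ : ℝ} (hβ₁ : 0 ≤ β₁) (hβ₂ : 0 ≤ β₂)
    {pen : Clustering n K → Finset (Fin n × Fin K) → ℝ}
    (hpen : pen = sepPenalty β₁ β₂ ∨ pen = nonsepPenalty β₁ β₂)
    {Z : Clustering n K} {L : Matrix (Fin n) (Fin K) ℝ}
    (hL : ∀ i l, L i l ∈ Set.Icc (0 : ℝ) 1)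
    (hL₀ : ∀ k l, (fun i : Community Z k => L i.1 l) ≠ 0) {A M : Matrix (Fin n) (Fin n) ℝ}
    (hA : ∀ i j, probMatrix Z L i j = 0 → A i j = 0)
    (hM : ∀ i j, M i j = probMatrix Z L i j ∨ i = j ∧ M i j = 0)
    {Zhat : Clustering n K} {Jhat : Finset (Fin n × Fin K)} (hsol : IsSolution pen A Zhat Jhat)
    {α δ t : ℝ} (hα : α ∈ Set.Ioc (0 : ℝ) 1) (ht : 0 < t)
    (hsep : SeparationCondition 1000 (2 * (β₁ + 2 * β₂)) α δ t Z L)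
    (hop : opSq Zhat (A - M) ≤
      16 * (4 * (blockSupport Zhat (probMatrix Z L)).card + n * Real.log K + t))
    (hlin : -frobInner (A - M) (probMatrix Z L) ≤
      α / 8 * frobSq (probMatrix Z L) + 2 * (t / α)) :
    misclustered Zhat Z ≤ δ := by
  by_contra! hfar
  set P := probMatrix Z L
  set h := entropyTerm (n * K) (blockSupport Zhat P).card
  let R := h + ((supportSet L).card + n * Real.log K + t)
  have hα0 : 0 < α := hα.1
  have hh : (blockSupport Zhat P).card ≤ h := le_entropyTerm (card_le_mul _)
  have hh0 : 0 ≤ h := (Nat.cast_nonneg _).trans hh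
  have hlog : 0 ≤ n * Real.log K := by positivity
  have hJ : (0 : ℝ) ≤ (supportSet L).card := Nat.cast_nonneg _
  have hupper := hsol.one_sub_mul_frobSq_le hβ₁ hβ₂ hpen hL₀ hA
    (fun i j => (hM i j).imp_right And.right) hα (R := R) (by linarith)
    ((frobSq_sub_probMatrix_le hL hM).trans (by linarith))
    (hlin.trans (by gcongr; linarith))
  have hsepR : (1 + α) * opSq Zhat P + 1000 * (R / α)
      + 2 * ((β₁ + 2 * β₂) * entropyTerm (n * K) (supportSet L).card) ≤ frobSq P := by
    refine le_of_eq_of_le ?_ (hsep Zhat hfar.le)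
    rw [opSq]
    ring
  refine hupper.not_gt (lt_of_separation hα (opSq_nonneg _ _) (by positivity) ?_ hsepR)
  exact mul_nonneg (by positivity) (entropyTerm_nonneg (card_le_mul _))

end Consistency

section RandomAdjacency

theorem log_le_four_mul_of_le_twentyFive_pow {N d : ℕ} (h : N ≤ 25 ^ d) : Real.log N ≤ 4 * d := by
  rcases N.eq_zero_or_pos with rfl | hN
  · simp
  have hlog : Real.log 25 ≤ 4 := by
    rw [Real.log_le_iff_le_exp (by norm_num)]
    calc (25 : ℝ) ≤ 2.7 ^ 4 := by norm_num
      _ ≤ Real.exp 1 ^ 4 := by gcongr; linarith [Real.exp_one_gt_d9]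
      _ = Real.exp 4 := by rw [← Real.exp_nat_mul]; norm_num
  calc Real.log N ≤ Real.log (25 ^ d) := Real.log_le_log (by positivity) (by exact_mod_cast h)
    _ = Real.log 25 * d := by rw [Real.log_pow, mul_comm]
    _ ≤ 4 * d := by gcongr

variable {n K : ℕ} {Ω : Type*} [MeasurableSpace Ω] {μ : Measure Ω}
  {A : Ω → Matrix (Fin n) (Fin n) ℝ} {P : Matrix (Fin n) (Fin n) ℝ}

theorem IsRandomAdjacency.meanMatrix_apply (hA : IsRandomAdjacency μ A P) (i j : Fin n) :
    meanMatrix μ A i j = μ.real {ω | A ω i j = 1} := by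
  have hmeas : MeasurableSet {ω | A ω i j = 1} :=
    hA.measurable i j (measurableSet_singleton 1)
  rw [meanMatrix, Matrix.of_apply, ← integral_indicator_one hmeas]
  refine integral_congr_ae (Filter.Eventually.of_forall fun ω => ?_)
  rcases hA.zero_or_one ω i j with h | h <;> simp [Set.indicator, h]

theorem IsRandomAdjacency.meanMatrix_eq (hA : IsRandomAdjacency μ A P)
    (hP : ∀ i j, P i j = P j i) (i j : Fin n) :
    meanMatrix μ A i j = P i j ∨ i = j ∧ meanMatrix μ A i j = 0 := by
  rw [hA.meanMatrix_apply]
  rcases lt_trichotomy i j with h | rfl | h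
  · exact Or.inl (hA.prob i j h)
  · refine hA.diag.imp (fun h => h i) fun h => ⟨rfl, ?_⟩
    simp [h]
  · refine Or.inl ?_
    simp only [hA.symm _ i j]
    rw [hA.prob j i h, hP]

theorem IsRandomAdjacency.meanMatrix_eq_zero (hA : IsRandomAdjacency μ A P)
    (hP : ∀ i j, P i j = P j i) {i j : Fin n} (h : P i j = 0) : meanMatrix μ A i j = 0 :=
  (hA.meanMatrix_eq hP i j).elim (·.trans h) And.right

variable [IsProbabilityMeasure μ]

theorem IsRandomAdjacency.ae_eq_zero (hA : IsRandomAdjacency μ A P)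
    (hP : ∀ i j, P i j = P j i) : ∀ᵐ ω ∂μ, ∀ i j, P i j = 0 → A ω i j = 0 := by
  refine ae_all_iff.mpr fun i => ae_all_iff.mpr fun j => ?_
  by_cases h : P i j = 0
  · have hone : μ {ω | A ω i j = 1} = 0 := by
      rw [← measureReal_eq_zero_iff, ← hA.meanMatrix_apply, hA.meanMatrix_eq_zero hP h]
    filter_upwards [measure_eq_zero_iff_ae_notMem.mp hone] with ω hω _
    exact (hA.zero_or_one ω i j).resolve_right hω
  · exact Filter.Eventually.of_forall fun _ h' => absurd h' h

theorem IsRandomAdjacency.measureReal_le_frobInner_le (hA : IsRandomAdjacency μ A P)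
    (M : Matrix (Fin n) (Fin n) ℝ) {θ : ℝ} (hθ : 0 < θ) (t : ℝ) :
    μ.real {ω | θ / 4 * frobSq M + t / θ ≤ frobInner (A ω - meanMatrix μ A) M} ≤
      Real.exp (-t) := by
  refine measureReal_le_frobInner_sub_meanMatrix_le (fun i j => (hA.measurable i j).aemeasurable)
    (fun i j => Filter.Eventually.of_forall fun ω => ?_) hA.symm hA.indep M hθ t
  rcases hA.zero_or_one ω i j with h | h <;> simp [h]

theorem IsRandomAdjacency.measureReal_lt_neg_frobInner_le (hA : IsRandomAdjacency μ A P)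
    (M : Matrix (Fin n) (Fin n) ℝ) {α : ℝ} (hα : 0 < α) (t : ℝ) :
    μ.real {ω | α / 8 * frobSq M + 2 * (t / α) < -frobInner (A ω - meanMatrix μ A) M} ≤
      Real.exp (-t) := by
  refine (measureReal_mono fun ω hω => ?_).trans
    (hA.measureReal_le_frobInner_le (-M) (half_pos hα) t)
  rw [Set.mem_ofPred_eq, frobSq_neg, frobInner_neg_right]
  refine le_of_eq_of_le ?_ (le_of_lt hω)
  field_simp
  ring

theorem IsRandomAdjacency.measureReal_le_frobInner_le_of_frobSq_le_one
    (hA : IsRandomAdjacency μ A P) {M : Matrix (Fin n) (Fin n) ℝ} (hM : frobSq M ≤ 1) {s : ℝ}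
    (hs : 0 < s) :
    μ.real {ω | s ≤ frobInner (A ω - meanMatrix μ A) M} ≤ Real.exp (-s ^ 2) := by
  refine (measureReal_mono fun ω hω => ?_).trans
    (hA.measureReal_le_frobInner_le M (mul_pos two_pos hs) (s ^ 2))
  refine le_trans ?_ (show s ≤ frobInner (A ω - meanMatrix μ A) M from hω)
  have hquot : s ^ 2 / (2 * s) = s / 2 := by field_simp
  rw [hquot]
  nlinarith

theorem mem_blockSupport_of_ne_zero (Z : Clustering n K) {i j : Fin n} (h : P i j ≠ 0) :
    (i, Z j) ∈ blockSupport Z P := by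
  simpa [blockSupport] using ⟨j, rfl, h⟩

theorem IsRandomAdjacency.measureReal_exists_lt_opSq_le (hA : IsRandomAdjacency μ A P)
    (hP : ∀ i j, P i j = P j i) {t : ℝ} (ht : 0 < t) :
    μ.real {ω | ∃ Z : Clustering n K,
      16 * (4 * (blockSupport Z P).card + n * Real.log K + t) < opSq Z (A ω - meanMatrix μ A)} ≤
      Real.exp (-t) := by
  choose T hcard hT hnet using fun Z : Clustering n K => exists_test_matrices Z (blockSupport Z P)
  let r (Z : Clustering n K) : ℝ :=
    Real.log (T Z).card + (Real.log (Fintype.card (Clustering n K)) + t)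
  have hr : ∀ Z, 0 < r Z := fun Z => by positivity
  have hr_le : ∀ Z, r Z ≤ 4 * (blockSupport Z P).card + n * Real.log K + t := fun Z => by
    have hlog : Real.log (Fintype.card (Clustering n K)) = n * Real.log K := by simp
    linarith [log_le_four_mul_of_le_twentyFive_pow (hcard Z), show r Z = _ from rfl]
  have htail := measureReal_exists_mem_le (μ := μ) (T := T)
    (E := fun Z M => {ω | √(r Z) ≤ frobInner (A ω - meanMatrix μ A) M}) fun Z M hM => by
      have h := hA.measureReal_le_frobInner_le_of_frobSq_le_one (hT Z M hM)
        (Real.sqrt_pos.mpr (hr Z))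
      rwa [Real.sq_sqrt (hr Z).le] at h
  refine (ENNReal.toReal_mono (measure_ne_top _ _) (measure_mono_ae ?_)).trans htail
  filter_upwards [hA.ae_eq_zero hP] with ω hω ⟨Z, hZ⟩
  have hsupp : ∀ i j, (A ω - meanMatrix μ A) i j ≠ 0 → P i j ≠ 0 := fun i j => mt fun h => by
    rw [Matrix.sub_apply, hω i j h, hA.meanMatrix_eq_zero hP h, sub_zero]
  by_contra! hsmall
  have hop := hnet Z _ √(r Z) (fun i j h => mem_blockSupport_of_ne_zero Z (hsupp i j h))
    (fun i j h => mem_blockSupport_of_ne_zero Z (hP i j ▸ hsupp i j h))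
    fun M hM => (not_le.mp fun h => hsmall ⟨Z, M, hM, h⟩).le
  rw [Real.sq_sqrt (hr Z).le] at hop
  exact hZ.not_ge (hop.trans (by gcongr; exact hr_le Z))

end RandomAdjacency

end PABM

end

theorem theorem2_general (β₁ β₂ : ℝ) (hβ₁ : 0 < β₁) (hβ₂ : 0 < β₂) :
    ∃ H₁ H₂ : ℝ, 0 < H₁ ∧ 0 < H₂ ∧
      ∀ (n K : ℕ) (Zstar : PABM.Clustering n K) (L : Matrix (Fin n) (Fin K) ℝ),
        (∀ i l, L i l ∈ Set.Icc (0 : ℝ) 1) →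
        (∀ k l, (fun i : PABM.Community Zstar k => L i.1 l) ≠ 0) →
      ∀ (Ω : Type*) [MeasurableSpace Ω] (μ : Measure Ω) [IsProbabilityMeasure μ]
        (A : Ω → Matrix (Fin n) (Fin n) ℝ),
        PABM.IsRandomAdjacency μ A (PABM.probMatrix Zstar L) →
      ∀ pen : PABM.Clustering n K → Finset (Fin n × Fin K) → ℝ,
        pen = PABM.sepPenalty β₁ β₂ ∨ pen = PABM.nonsepPenalty β₁ β₂ →
      ∀ α ∈ Set.Ioc (0 : ℝ) 1, ∀ δ t : ℝ, 0 < t →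
        PABM.SeparationCondition H₁ H₂ α δ t Zstar L →
        1 - 2 * Real.exp (-t) ≤
          μ.real {ω | ∀ Zhat Jhat, PABM.IsSolution pen (A ω) Zhat Jhat →
            PABM.misclustered Zhat Zstar ≤ δ} := by
  refine ⟨1000, 2 * (β₁ + 2 * β₂), by norm_num, by positivity, ?_⟩
  intro n K Zstar L hL hL₀ Ω _ μ _ A hA pen hpen α hα δ t ht hsep
  have hP := PABM.probMatrix_symm Zstar L
  have hnoise := hA.measureReal_exists_lt_opSq_le (K := K) hP ht
  have hlin := hA.measureReal_lt_neg_frobInner_le (PABM.probMatrix Zstar L) hα.1 t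
  have hbad := sub_le_sub_left (add_le_add hnoise hlin) 1
  rw [← two_mul] at hbad
  refine hbad.trans (PABM.one_sub_add_le_measureReal ?_)
  filter_upwards [hA.ae_eq_zero hP] with ω hω hop hinner Zhat Jhat hsol
  exact hsol.misclustered_le hβ₁.le hβ₂.le hpen hL hL₀ hω (hA.meanMatrix_eq hP) hα ht hsep
    (not_lt.mp (not_exists.mp hop Zhat)) (not_lt.mp hinner)

theorem theorem2 (β₁ β₂ : ℝ) (hβ₁ : 0 < β₁) (hβ₂ : 0 < β₂) :
    ∃ H₁ H₂ : ℝ, 0 < H₁ ∧ 0 < H₂ ∧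
      ∀ (n K : ℕ), 2 ≤ K →
      ∀ (Zstar : PABM.Clustering n K) (L : Matrix (Fin n) (Fin K) ℝ),
        (∀ i l, L i l ∈ Set.Icc (0 : ℝ) 1) →
        PABM.LinIndepPopularities Zstar L →
      ∀ (Ω : Type*) [MeasurableSpace Ω] (μ : Measure Ω) [IsProbabilityMeasure μ]
        (A : Ω → Matrix (Fin n) (Fin n) ℝ),
        PABM.IsRandomAdjacency μ A (PABM.probMatrix Zstar L) →
      ∀ pen : PABM.Clustering n K → Finset (Fin n × Fin K) → ℝ,
        pen = PABM.sepPenalty β₁ β₂ ∨ pen = PABM.nonsepPenalty β₁ β₂ →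
      ∀ α ∈ Set.Ioo (0 : ℝ) (1 / 2), ∀ δ ∈ Set.Ioo (0 : ℝ) 1, ∀ t : ℝ, 0 < t →
        PABM.SeparationCondition H₁ H₂ α δ t Zstar L →
        1 - 2 * Real.exp (-t) ≤
          μ.real {ω | ∀ Zhat Jhat, PABM.IsSolution pen (A ω) Zhat Jhat →
            PABM.misclustered Zhat Zstar ≤ δ} := by
  obtain ⟨H₁, H₂, hH₁, hH₂, h⟩ := theorem2_general β₁ β₂ hβ₁ hβ₂
  exact ⟨H₁, H₂, hH₁, hH₂, fun n K _ Z L hL hind Ω _ μ _ A hA pen hpen α hα δ _ =>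
    h n K Z L hL (fun k l => (hind k).ne_zero l) Ω μ A hA pen hpen α
      ⟨hα.1, by linarith [hα.2]⟩ δ⟩
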